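/- Conventions. Let $k$ be a field. All quivers are finite and connected. For a quiver $Q$, the path algebra $kQ$ has the paths of $Q$ (including a stationary path at each vertex) as a basis, with composition of paths (or $0$) as product; $F\subset kQ$ is the two-sided ideal generated by the arrows. A two-sided ideal $I$ of $kQ$ is admissible if $F^m\subseteq I\subseteq F^2$ for some $m\ge 2$. A pair $(Q,I)$ is a presentation of a $k$-algebra $A$ if $I$ is admissible and is the kernel of a surjective algebra morphism $kQ\to A$; $A$ is triangular if it has such a presentation in which $Q$ (which is determined by $A$) has no oriented cycle. A minimal relation of $I$ is an element $\sum_{i=1}^m\lambda_iw_i\in I$ with $m\ge2$, $\lambda_i\in k\setminus\{0\}$ and $w_i$ distinct parallel paths, such that $\sum_{i\in J}\lambda_iw_i\notin I$ for every nonempty proper subset $J\subset\{1,\dots,m\}$. Homotopy is the smallest equivalence relation on the walks of $Q$ (compositions of arrows and formal inverses of arrows) which is compatible with composition, with $\alpha\alpha^{-1}\sim e_{x}$ and $\alpha^{-1}\alpha\sim e_{y}$ for every arrow $\alpha:x\to y$, and $w_i\sim w_j$ for all paths $w_i,w_j$ in a common minimal relation. The fundamental group $\pi_1(Q,I)$ is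 the group of homotopy classes of closed walks at a base point. The coproduct $(Q',I')\sqcup(Q'',I'')$ of bound quivers with base points $v',v''$ is obtained from the disjoint union of $Q'$ and $Q''$ by identifying $v'$ with $v''$, with the ideal generated by $I'$ and $I''$. A group $H$ is said to be without free generators if it has a finite presentation $\langle S\mid R\rangle$ in which every generator occurs in the reduced word of some relator. $\mathbb Z^{\sqcup m}$ is the free group of rank $m$ and $\sqcup$ denotes the free product of groups. Proposition. Let $k$ be a field and let $G$ be a finitely presented group. Then there are a triangular $k$-algebra $A$, a quiver $Q_G$ without oriented cycles and two presentations $(Q_G,J_G)$ and $(Q_G,\bar J_G)$ of $A$ such that, for every choice of the base point, $\pi_1(Q_G,J_G)\cong G$ and $\pi_1(Q_G,\bar J_G)$ is trivial. More precisely, $G\cong\mathbb Z^{\sqcup m}\sqcup H$ for some $m\ge0$ and some finitely presented group $H$ without free generators; and for every such decomposition of $G$ the above $A$, $Q_G$, $J_G$, $\bar J_G$ can be chosen so that $(Q_G,J_G)=(O,L)\sqcup(Q_H,I)$ and $(Q_G,\bar J_G)=(O,\bar L)\sqcup(Q_H,\bar I)$, with the same base points in $O$ and $Q_H$ for both coproducts,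 where $O$ and $Q_H$ are quivers without oriented cycles, $(O,L)$ and $(O,\bar L)$ are presentations of one triangular algebra with $\pi_1(O,L)\cong\mathbb Z^{\sqcup m}$ and $\pi_1(O,\bar L)$ trivial, and $(Q_H,I)$ and $(Q_H,\bar I)$ are presentations of one triangular algebra with $\pi_1(Q_H,I)\cong H$ and $\pi_1(Q_H,\bar I)$ trivial (again for every choice of the base points of the fundamental groups). -/

import Mathlib

universe u v w

noncomputable section

namespace BoundQuiver

/-! ### Finite connected quivers -/

/-- The quivers under consideration: finitely many vertices, finitely many arrows, and connected
underlying graph (nonempty, and any two vertices are joined by a walk). A walk is a path in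
`Quiver.Symmetrify`, in which a formal inverse has been added for each arrow. -/
structure FinConnQuiver where
  Vert : Type
  [quiver : Quiver.{0} Vert]
  [fintypeVert : Fintype Vert]
  [finiteHom : ∀ x y : Vert, Finite (x ⟶ y)]
  nonempty : Nonempty Vert
  connected : ∀ x y : Quiver.Symmetrify Vert, Nonempty (Quiver.Path x y)

attribute [instance] FinConnQuiver.quiver FinConnQuiver.fintypeVert FinConnQuiver.finiteHom

/-- No oriented cycles: every path from a vertex to itself is stationary. -/
def IsAcyclic (V : Type*) [Quiver V] : Prop :=
  ∀ (x : V) (p : Quiver.Path x x), p = Quiver.Path.nil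

/-! ### The path algebra -/

/-- A path of a quiver together with its source and its target. -/
structure TotalPath (V : Type*) [Quiver V] where
  src : V
  tgt : V
  path : Quiver.Path src tgt

/-- The path algebra `kQ`: the vector space with basis the paths of `Q`, including the stationary
path at each vertex. -/
def PathAlgebra (k : Type*) (V : Type*) [Field k] [Quiver V] := TotalPath V →₀ k

namespace PathAlgebra

variable {k : Type*} {V : Type*} [Field k] [Quiver V]

instance : AddCommGroup (PathAlgebra k V) := inferInstanceAs (AddCommGroup (TotalPath V →₀ k))
instance : Module k (PathAlgebra k V) := inferInstanceAs (Module k (TotalPath V →₀ k))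

/-- The basis element given by a path. -/
def ofPath {x y : V} (p : Quiver.Path x y) : PathAlgebra k V :=
  Finsupp.single (⟨x, y, p⟩ : TotalPath V) (1 : k)

/-- The product of two basis elements: their composition if it is possible, `0` otherwise. -/
def basisMul (p q : TotalPath V) : PathAlgebra k V :=
  open Classical in
  if h : q.src = p.tgt then ofPath (p.path.comp (q.path.cast h rfl)) else 0

/-- The bilinear extension of `basisMul`. -/
def mulHom : PathAlgebra k V →ₗ[k] PathAlgebra k V →ₗ[k] PathAlgebra k V :=
  Finsupp.linearCombination k fun p : TotalPath V =>
    (Finsupp.linearCombination k fun q : TotalPath V =>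
      (basisMul p q : PathAlgebra k V) : (TotalPath V →₀ k) →ₗ[k] PathAlgebra k V)

instance : Mul (PathAlgebra k V) := ⟨fun f g => mulHom f g⟩

/-- The unit is the sum of the stationary paths. -/
instance [Fintype V] : One (PathAlgebra k V) :=
  ⟨∑ x : V, ofPath (Quiver.Path.nil : Quiver.Path x x)⟩

theorem mul_def (f g : PathAlgebra k V) : f * g = mulHom f g := rfl

theorem one_def [Fintype V] :
    (1 : PathAlgebra k V) = ∑ x : V, ofPath (Quiver.Path.nil : Quiver.Path x x) := rfl

theorem ofPath_mul_ofPath {x y x' y' : V} (p : Quiver.Path x y) (q : Quiver.Path x' y') :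
    (ofPath p * ofPath q : PathAlgebra k V) = basisMul ⟨x, y, p⟩ ⟨x', y', q⟩ := by
  have h1 : mulHom (ofPath p : PathAlgebra k V) =
      (Finsupp.linearCombination k fun q : TotalPath V =>
        (basisMul ⟨x, y, p⟩ q : PathAlgebra k V)) :=
    (Finsupp.linearCombination_single k (1 : k) (⟨x, y, p⟩ : TotalPath V)).trans (one_smul k _)
  have h2 : (Finsupp.linearCombination k fun q : TotalPath V =>
      (basisMul ⟨x, y, p⟩ q : PathAlgebra k V)) (ofPath q) = basisMul ⟨x, y, p⟩ ⟨x', y', q⟩ :=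
    (Finsupp.linearCombination_single k (1 : k) (⟨x', y', q⟩ : TotalPath V)).trans (one_smul k _)
  exact (congrArg (fun T => T (ofPath q)) h1).trans h2

theorem ofPath_mul_ofPath_comp {x y z : V} (p : Quiver.Path x y) (q : Quiver.Path y z) :
    (ofPath p * ofPath q : PathAlgebra k V) = ofPath (p.comp q) := by
  rw [ofPath_mul_ofPath, basisMul, dif_pos rfl]
  rfl

theorem ofPath_mul_ofPath_ne {x y x' y' : V} (p : Quiver.Path x y) (q : Quiver.Path x' y')
    (h : x' ≠ y) : (ofPath p * ofPath q : PathAlgebra k V) = 0 := by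
  rw [ofPath_mul_ofPath, basisMul, dif_neg h]

/-- Two linear maps that agree on paths are equal. -/
theorem lhom_ext {M : Type*} [AddCommGroup M] [Module k M] {f g : PathAlgebra k V →ₗ[k] M}
    (h : ∀ (x y : V) (p : Quiver.Path x y), f (ofPath p) = g (ofPath p)) : f = g :=
  Finsupp.lhom_ext' fun p => LinearMap.ext_ring (h p.src p.tgt p.path)

theorem mulHom_ofPath_assoc {x y x' y' x'' y'' : V} (p : Quiver.Path x y) (q : Quiver.Path x' y')
    (r : Quiver.Path x'' y'') :
    (ofPath p * ofPath q * ofPath r : PathAlgebra k V) = ofPath p * (ofPath q * ofPath r) := by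
  by_cases h : x' = y
  · subst h
    by_cases h' : x'' = y'
    · subst h'
      simp only [ofPath_mul_ofPath_comp, Quiver.Path.comp_assoc]
    · rw [ofPath_mul_ofPath_comp, ofPath_mul_ofPath_ne _ _ h', ofPath_mul_ofPath_ne _ _ h']
      exact (map_zero (mulHom (ofPath p))).symm
  · rw [ofPath_mul_ofPath_ne _ _ h]
    have h0 : (0 * ofPath r : PathAlgebra k V) = 0 := by
      rw [mul_def, map_zero, LinearMap.zero_apply]
    rw [h0]
    by_cases h' : x'' = y'
    · subst h'
      rw [ofPath_mul_ofPath_comp, ofPath_mul_ofPath_ne _ _ h]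
    · rw [ofPath_mul_ofPath_ne _ _ h']
      exact (map_zero (mulHom (ofPath p))).symm

theorem mul_assoc' (f g h : PathAlgebra k V) : f * g * h = f * (g * h) := by
  let L : PathAlgebra k V →ₗ[k] PathAlgebra k V →ₗ[k] PathAlgebra k V →ₗ[k] PathAlgebra k V :=
    (mulHom (k := k) (V := V)).compr₂ mulHom
  let R : PathAlgebra k V →ₗ[k] PathAlgebra k V →ₗ[k] PathAlgebra k V →ₗ[k] PathAlgebra k V :=
    LinearMap.mk₂ k (fun f g => (mulHom f) ∘ₗ (mulHom g))
      (by intros; ext1; simp) (by intros; ext1; simp) (by intros; ext1; simp)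
      (by intros; ext1; simp)
  have hLR : L = R := by
    refine lhom_ext fun x y p => lhom_ext fun x' y' q => lhom_ext fun x'' y'' r => ?_
    exact mulHom_ofPath_assoc p q r
  exact congrArg (fun T => T f g h) hLR

theorem one_mul' [Fintype V] (f : PathAlgebra k V) : 1 * f = f := by
  have h : mulHom (1 : PathAlgebra k V) = LinearMap.id := by
    refine lhom_ext fun x y p => ?_
    rw [one_def, map_sum, LinearMap.sum_apply, Finset.sum_eq_single x]
    · change ofPath _ * ofPath p = _
      rw [ofPath_mul_ofPath_comp, Quiver.Path.nil_comp]
      rfl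
    · intro z _ hz
      exact ofPath_mul_ofPath_ne _ _ hz.symm
    · simp
  exact congrArg (fun T => T f) h

theorem mul_one' [Fintype V] (f : PathAlgebra k V) : f * 1 = f := by
  have h : (mulHom (k := k) (V := V)).flip 1 = LinearMap.id := by
    refine lhom_ext fun x y p => ?_
    rw [LinearMap.flip_apply, one_def, map_sum, Finset.sum_eq_single y]
    · change ofPath p * ofPath _ = _
      rw [ofPath_mul_ofPath_comp, Quiver.Path.comp_nil]
      rfl
    · intro z _ hz
      exact ofPath_mul_ofPath_ne _ _ hz
    · simp
  exact congrArg (fun T => T f) h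

instance [Fintype V] : Ring (PathAlgebra k V) :=
  { (inferInstance : AddCommGroup (PathAlgebra k V)) with
    mul := (· * ·)
    one := 1
    mul_assoc := mul_assoc'
    one_mul := one_mul'
    mul_one := mul_one'
    zero_mul := fun f => by rw [mul_def, map_zero, LinearMap.zero_apply]
    mul_zero := fun f => by rw [mul_def, map_zero]
    left_distrib := fun f g h => by simp only [mul_def, map_add]
    right_distrib := fun f g h => by simp only [mul_def, map_add, LinearMap.add_apply] }

instance [Fintype V] : Algebra k (PathAlgebra k V) :=
  Algebra.ofModule
    (fun r f g => by
      change mulHom (r • f) g = r • mulHom f g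
      rw [map_smul, LinearMap.smul_apply])
    (fun r f g => by
      change mulHom f (r • g) = r • mulHom f g
      rw [map_smul])

/-- The linear map `kQ' → kQ` induced by a morphism of quivers `Q' → Q`. -/
def map (k : Type*) [Field k] {V W : Type*} [Quiver V] [Quiver W] (F : V ⥤q W) :
    PathAlgebra k V →ₗ[k] PathAlgebra k W :=
  Finsupp.lmapDomain k k fun p : TotalPath V => ⟨F.obj p.src, F.obj p.tgt, F.mapPath p.path⟩

/-- The identification of linear combinations of paths from `x` to `y` with elements of
`e_x (kQ) e_y`. -/
def ofParallel (k : Type*) [Field k] {V : Type*} [Quiver V] (x y : V) :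
    (Quiver.Path x y →₀ k) →ₗ[k] PathAlgebra k V :=
  Finsupp.lmapDomain k k fun p => (⟨x, y, p⟩ : TotalPath V)

end PathAlgebra

/-! ### Admissible ideals, presentations, triangular algebras -/

section Presentations

variable (k : Type u) [Field k]

/-- The two-sided ideal generated by a set. -/
def twoSidedSpan {R : Type*} [Ring R] (s : Set R) : Ideal R :=
  TwoSidedIdeal.asIdeal (TwoSidedIdeal.span s)

/-- The two-sided ideal `F` of `kQ` generated by the arrows. -/
def arrowIdeal (V : Type*) [Quiver V] [Fintype V] : Ideal (PathAlgebra k V) :=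
  twoSidedSpan {f | ∃ (x y : V) (α : x ⟶ y), f = PathAlgebra.ofPath α.toPath}

/-- A two-sided ideal `I` is admissible if `F ^ m ⊆ I ⊆ F ^ 2` for some `m ≥ 2`. -/
structure IsAdmissible {V : Type*} [Quiver V] [Fintype V] (I : Ideal (PathAlgebra k V)) :
    Prop where
  isTwoSided : I.IsTwoSided
  exists_pow_le : ∃ m : ℕ, 2 ≤ m ∧ arrowIdeal k V ^ m ≤ I
  le_sq : I ≤ arrowIdeal k V ^ 2

/-- `(Q, I)` is a presentation of the algebra `A`: the ideal `I` is admissible and it is the kernel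
of a surjective morphism of algebras `kQ → A`. -/
def IsPresentation (Q : FinConnQuiver) (I : Ideal (PathAlgebra k Q.Vert))
    (A : Type*) [Ring A] [Algebra k A] : Prop :=
  IsAdmissible k I ∧
    ∃ ν : PathAlgebra k Q.Vert →ₐ[k] A, Function.Surjective ν ∧ RingHom.ker ν = I

/-- `A` is a triangular algebra: it is presented by a finite connected quiver without oriented
cycles. (The quiver in a presentation of `A` is determined by `A` up to isomorphism.) -/
def IsTriangularAlgebra (A : Type*) [Ring A] [Algebra k A] : Prop :=
  ∃ (Q : FinConnQuiver) (I : Ideal (PathAlgebra k Q.Vert)),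
    IsAcyclic Q.Vert ∧ IsPresentation k Q I A

end Presentations

/-! ### Homotopy of walks and the fundamental group -/

section Homotopy

variable {k : Type*} [Field k] {V : Type*} [Quiver V] [Fintype V]

/-- The linear combination `ρ = ∑ λ_i w_i` of pairwise distinct paths `w_i : x → y` with nonzero
coefficients (the support of `ρ` is the set of the `w_i`) is a minimal relation of `I`: it lies in
`I`, it has at least two terms, and no nonempty proper partial sum lies in `I`. -/
structure IsMinimalRelation (I : Ideal (PathAlgebra k V)) {x y : V}
    (ρ : Quiver.Path x y →₀ k) : Prop where
  mem : PathAlgebra.ofParallel k x y ρ ∈ I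
  two_le : 2 ≤ ρ.support.card
  partial_notMem : ∀ T : Finset (Quiver.Path x y), T.Nonempty → T ⊂ ρ.support →
    PathAlgebra.ofParallel k x y (∑ p ∈ T, Finsupp.single p (ρ p)) ∉ I

/-- Walks from `x` to `y`: compositions of arrows and formal inverses of arrows. -/
abbrev Walk {V : Type*} [Quiver V] (x y : Quiver.Symmetrify V) : Type _ :=
  Quiver.Path x y

/-- A path regarded as a walk. -/
def toWalk {V : Type*} [Quiver V] {x y : V} (p : Quiver.Path x y) :
    Walk (Quiver.Symmetrify.of.obj x) (Quiver.Symmetrify.of.obj y) :=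
  Quiver.Symmetrify.of.mapPath p

/-- An arrow regarded as a walk. -/
def arrowWalk {V : Type*} [Quiver V] {x y : V} (α : x ⟶ y) :
    Walk (Quiver.Symmetrify.of.obj x) (Quiver.Symmetrify.of.obj y) :=
  (Quiver.Symmetrify.of.map α).toPath

/-- The formal inverse of an arrow regarded as a walk. -/
def invArrowWalk {V : Type*} [Quiver V] {x y : V} (α : x ⟶ y) :
    Walk (Quiver.Symmetrify.of.obj y) (Quiver.Symmetrify.of.obj x) :=
  (Quiver.reverse (Quiver.Symmetrify.of.map α)).toPath

/-- The homotopy relation of `(Q, I)`: the smallest equivalence relation on walks that cancels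
`α α⁻¹` and `α⁻¹ α`, identifies the paths of each minimal relation, and is compatible with
composition. -/
inductive Homotopic (I : Ideal (PathAlgebra k V)) :
    ∀ {x y : Quiver.Symmetrify V}, Walk x y → Walk x y → Prop
  | refl {x y : Quiver.Symmetrify V} (p : Walk x y) : Homotopic I p p
  | symm {x y : Quiver.Symmetrify V} {p q : Walk x y} : Homotopic I p q → Homotopic I q p
  | trans {x y : Quiver.Symmetrify V} {p q r : Walk x y} :
      Homotopic I p q → Homotopic I q r → Homotopic I p r
  | arrow_inv {x y : V} (α : x ⟶ y) :
      Homotopic I ((arrowWalk α).comp (invArrowWalk α)) Quiver.Path.nil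
  | inv_arrow {x y : V} (α : x ⟶ y) :
      Homotopic I ((invArrowWalk α).comp (arrowWalk α)) Quiver.Path.nil
  | minimal {x y : V} (ρ : Quiver.Path x y →₀ k) (hρ : IsMinimalRelation I ρ)
      (p q : Quiver.Path x y) (hp : p ∈ ρ.support) (hq : q ∈ ρ.support) :
      Homotopic I (toWalk p) (toWalk q)
  | comp {x y z t : Quiver.Symmetrify V} (p : Walk x y) {q r : Walk y z} (s : Walk z t) :
      Homotopic I q r → Homotopic I ((p.comp q).comp s) ((p.comp r).comp s)

variable {x y z : Quiver.Symmetrify V}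

theorem Homotopic.comp_both {I : Ideal (PathAlgebra k V)} {p p' : Walk x y}
    {q q' : Walk y z} (hp : Homotopic I p p') (hq : Homotopic I q q') :
    Homotopic I (p.comp q) (p'.comp q') := by
  have h1 := Homotopic.comp (Quiver.Path.nil : Walk x x) q hp
  have h2 := Homotopic.comp p' (Quiver.Path.nil : Walk z z) hq
  rw [Quiver.Path.nil_comp, Quiver.Path.nil_comp] at h1
  exact h1.trans h2

theorem Homotopic.edge_inv (I : Ideal (PathAlgebra k V)) (e : x ⟶ y) :
    Homotopic I (e.toPath.comp (Quiver.reverse e).toPath) Quiver.Path.nil := by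
  rcases e with α | α
  · exact Homotopic.arrow_inv α
  · exact Homotopic.inv_arrow α

theorem Homotopic.comp_reverse (I : Ideal (PathAlgebra k V)) (p : Walk x y) :
    Homotopic I (p.comp p.reverse) Quiver.Path.nil := by
  induction p with
  | nil => exact Homotopic.refl _
  | cons p e ih =>
    have h3 := Homotopic.comp p p.reverse (Homotopic.edge_inv I e)
    rw [Quiver.Path.comp_nil] at h3
    have h4 : (p.cons e).comp (p.cons e).reverse =
        (p.comp (e.toPath.comp (Quiver.reverse e).toPath)).comp p.reverse := by
      rw [Quiver.Path.reverse, ← Quiver.Path.comp_assoc, ← Quiver.Path.comp_assoc]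
      rfl
    rw [h4]
    exact h3.trans ih

theorem Homotopic.reverse_comp (I : Ideal (PathAlgebra k V)) (p : Walk x y) :
    Homotopic I (p.reverse.comp p) Quiver.Path.nil := by
  have h := Homotopic.comp_reverse I p.reverse
  rwa [Quiver.Path.reverse_reverse] at h

theorem Homotopic.reverse_congr {I : Ideal (PathAlgebra k V)} {p q : Walk x y}
    (h : Homotopic I p q) : Homotopic I p.reverse q.reverse := by
  have h1 := Homotopic.comp p.reverse q.reverse h
  have h2 := (Homotopic.reverse_comp I p).comp_both (Homotopic.refl (I := I) q.reverse)
  have h3 := (Homotopic.refl (I := I) p.reverse).comp_both (Homotopic.comp_reverse I q)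
  rw [Quiver.Path.nil_comp] at h2
  rw [Quiver.Path.comp_nil, ← Quiver.Path.comp_assoc] at h3
  exact (h3.symm.trans h1.symm).trans h2

/-- Homotopy as an equivalence relation on the closed walks at `v₀`. -/
def homotopySetoid (I : Ideal (PathAlgebra k V)) (v₀ : V) :
    Setoid (Walk (Quiver.Symmetrify.of.obj v₀) (Quiver.Symmetrify.of.obj v₀)) where
  r p q := Homotopic I p q
  iseqv := ⟨Homotopic.refl, Homotopic.symm, Homotopic.trans⟩

/-- The fundamental group `π₁(Q, I, v₀)`: closed walks at `v₀` up to homotopy. -/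
def FundamentalGroup (I : Ideal (PathAlgebra k V)) (v₀ : V) : Type _ :=
  Quotient (homotopySetoid I v₀)

/-- The product is induced by the composition of walks. -/
instance (I : Ideal (PathAlgebra k V)) (v₀ : V) : Group (FundamentalGroup I v₀) where
  mul := Quotient.map₂ (fun p q => p.comp q) fun _ _ hp _ _ hq => hp.comp_both hq
  one := Quotient.mk _ Quiver.Path.nil
  inv := Quotient.map (fun p => p.reverse) fun _ _ h => h.reverse_congr
  mul_assoc := by
    rintro ⟨p⟩ ⟨q⟩ ⟨r⟩
    exact congrArg (Quotient.mk _) (Quiver.Path.comp_assoc p q r)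
  one_mul := by
    rintro ⟨p⟩
    exact congrArg (Quotient.mk _) (Quiver.Path.nil_comp p)
  mul_one := by
    rintro ⟨p⟩
    rfl
  inv_mul_cancel := by
    rintro ⟨p⟩
    exact Quotient.sound (Homotopic.reverse_comp I p)

end Homotopy

/-! ### Coproducts of pointed bound quivers -/

section Coproduct

/-- `ι₁` and `ι₂` exhibit `Q` as the quiver obtained from the disjoint union of `Q₁` and `Q₂` by
identifying the vertex `v₁` of `Q₁` with the vertex `v₂` of `Q₂`. -/
structure IsWedge {V₁ V₂ V : Type*} [Quiver V₁] [Quiver V₂] [Quiver V]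
    (ι₁ : V₁ ⥤q V) (ι₂ : V₂ ⥤q V) (v₁ : V₁) (v₂ : V₂) : Prop where
  injective_left : Function.Injective ι₁.obj
  injective_right : Function.Injective ι₂.obj
  obj_eq_iff : ∀ x y, ι₁.obj x = ι₂.obj y ↔ x = v₁ ∧ y = v₂
  obj_surjective : ∀ z, (∃ x, ι₁.obj x = z) ∨ ∃ y, ι₂.obj y = z
  arrow_bijective : Function.Bijective
    (Sum.elim (fun α => ⟨ι₁.obj α.1, ι₁.obj α.2.1, ι₁.map α.2.2⟩)
        (fun α => ⟨ι₂.obj α.1, ι₂.obj α.2.1, ι₂.map α.2.2⟩) :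
      (Σ x y : V₁, x ⟶ y) ⊕ (Σ x y : V₂, x ⟶ y) → Σ x y : V, x ⟶ y)

/-- The ideal `I₁ + I₂` of the coproduct: the two-sided ideal of `kQ` generated by the images of
`I₁` and `I₂`. -/
def coproductIdeal {k : Type*} [Field k] {V₁ V₂ V : Type*} [Quiver V₁] [Quiver V₂] [Quiver V]
    [Fintype V₁] [Fintype V₂] [Fintype V] (ι₁ : V₁ ⥤q V) (ι₂ : V₂ ⥤q V)
    (I₁ : Ideal (PathAlgebra k V₁)) (I₂ : Ideal (PathAlgebra k V₂)) : Ideal (PathAlgebra k V) :=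
  twoSidedSpan (PathAlgebra.map k ι₁ '' I₁ ∪ PathAlgebra.map k ι₂ '' I₂)

end Coproduct

/-! ### Groups -/

/-- `H` has a finite presentation `⟨x_1, …, x_n | R⟩` without free generators: every generator
occurs in (the reduced word of) some relator. -/
def HasPresentationWithoutFreeGenerators (H : Type*) [Group H] : Prop :=
  ∃ (n : ℕ) (R : Set (FreeGroup (Fin n))), R.Finite ∧
    (∀ i : Fin n, ∃ r ∈ R, ∃ b : Bool, (i, b) ∈ r.toWord) ∧ Nonempty (PresentedGroup R ≃* H)

/-- `A` is a triangular algebra with the two presentations `(Q, J)` and `(Q, J')`, whose quiver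
has no oriented cycles, such that `π₁(Q, J) ≅ G` and `π₁(Q, J')` is trivial (for every choice of
the base point). -/
structure IsTwinPresentation (k : Type*) [Field k] (Q : FinConnQuiver)
    (J J' : Ideal (PathAlgebra k Q.Vert)) (A : Type*) [Ring A] [Algebra k A]
    (G : Type*) [Group G] : Prop where
  triangular : IsTriangularAlgebra k A
  acyclic : IsAcyclic Q.Vert
  presentation : IsPresentation k Q J A
  presentation' : IsPresentation k Q J' A
  fundamentalGroup : ∀ v₀ : Q.Vert, Nonempty (FundamentalGroup J v₀ ≃* G)
  fundamentalGroup' : ∀ v₀ : Q.Vert, Subsingleton (FundamentalGroup J' v₀)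

end BoundQuiver

end

/-! In a star quiver, each index `j` contributes a ray: arrows from the centre to `mid j`, then
arrows from `mid j` to `fin j`. All paths have length at most two. Labelling some paths of length
two determines an admissible ideal, spanned by the unlabelled ones and the differences of equally
labelled ones. The paths of a minimal relation all carry one label, and two distinct parallel paths
with a common label form a minimal relation. Hence the fundamental group is generated by the arrows,
with one base arrow in each layer of each ray trivial and equally labelled products equal
(`Star.nonempty_mulEquiv_of_isLabelGroup`).

For a finite presentation with generators `x_i`, use a ray whose first layer is `shift`, `one` and
`gen i`, and whose second layer is `none` and one arrow for each suffix `s` of a relator. The path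
`one`, `s` is labelled by the class of `s`, and `gen i`, `s` by the class of `x_i s`. Comparing
labels letter by letter forces the arrow `s` to be the word `s` in the `gen i`
(`eq_lift_of_compatible`). A whole relator shares the label 1 with `one`, `none`, so it becomes
trivial. Conversely all labels are products of weights in the presented group, so nothing else
collapses.

Moreover `gen i`, `none` and `shift`, `s` are zero, while `shift`, `none` is identified with `one`,
`none`. The automorphism `gen i ↦ gen i + shift` of the path algebra therefore pulls the ideal back
to one that differs only in identifying `gen i`, `none` with `one`, `none` (`isTwist_presLabel`).
The quotient algebra is the same up to isomorphism, but now every `gen i` is trivial and the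
fundamental group vanishes.

Generators occurring in no relator split off a free factor. A star with two rays, one for the free
factor (no relators) and one for `H`, is a wedge at the centre. Its ideals are generated ray by ray,
and the universal property of the free product computes its fundamental group. -/

namespace BoundQuiver

/-! ### Computing the fundamental group -/

section Walks

variable {V : Type*} [Quiver V] {G : Type*} [Group G]

/-- The weight of an edge of the symmetrified quiver, given weights of the arrows in a group. -/
def edgeWeight (val : ∀ x y : V, (x ⟶ y) → G) :
    ∀ {x y : Quiver.Symmetrify V}, (x ⟶ y) → G
  | x, y, Sum.inl α => val x y α
  | x, y, Sum.inr α => (val y x α)⁻¹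

/-- The weight of a walk: the product of the weights of its edges. -/
def walkWeight (val : ∀ x y : V, (x ⟶ y) → G) {x : Quiver.Symmetrify V} :
    ∀ {y : Quiver.Symmetrify V}, Walk x y → G
  | _, Quiver.Path.nil => 1
  | _, Quiver.Path.cons p e => walkWeight val p * edgeWeight val e

variable (val : ∀ x y : V, (x ⟶ y) → G)

theorem walkWeight_comp {x y z : Quiver.Symmetrify V} (p : Walk x y) (q : Walk y z) :
    walkWeight val (p.comp q) = walkWeight val p * walkWeight val q := by
  induction q with
  | nil => simp [walkWeight]
  | cons q e ih => simp only [Quiver.Path.comp_cons, walkWeight, ih, mul_assoc]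

theorem walkWeight_arrowWalk {x y : V} (α : x ⟶ y) :
    walkWeight val (arrowWalk α) = val x y α := one_mul _

theorem walkWeight_invArrowWalk {x y : V} (α : x ⟶ y) :
    walkWeight val (invArrowWalk α) = (val x y α)⁻¹ := one_mul _

variable {k : Type*} [Field k] [Fintype V] {I : Ideal (PathAlgebra k V)}

/-- The weights of the arrows take the same value on the paths of each minimal relation. -/
def RespectsRelations (I : Ideal (PathAlgebra k V)) (val : ∀ x y : V, (x ⟶ y) → G) : Prop :=
  ∀ {x y : V} (ρ : Quiver.Path x y →₀ k), IsMinimalRelation I ρ → ∀ p ∈ ρ.support,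
    ∀ q ∈ ρ.support, walkWeight val (toWalk p) = walkWeight val (toWalk q)

theorem Homotopic.walkWeight_eq {val : ∀ x y : V, (x ⟶ y) → G} (hI : RespectsRelations I val)
    {x y : Quiver.Symmetrify V} {p q : Walk x y} (h : Homotopic I p q) :
    walkWeight val p = walkWeight val q := by
  induction h with
  | refl => rfl
  | symm _ ih => exact ih.symm
  | trans _ _ ih ih' => exact ih.trans ih'
  | arrow_inv α =>
    rw [walkWeight_comp, walkWeight_arrowWalk, walkWeight_invArrowWalk, mul_inv_cancel]; rfl
  | inv_arrow α =>
    rw [walkWeight_comp, walkWeight_arrowWalk, walkWeight_invArrowWalk, inv_mul_cancel]; rfl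
  | minimal ρ hρ p q hp hq => exact hI ρ hρ p hp q hq
  | comp p s _ ih => simp only [walkWeight_comp, ih]

/-- The homomorphism from the fundamental group given by weights of the arrows. -/
def FundamentalGroup.weightHom {val : ∀ x y : V, (x ⟶ y) → G} (hI : RespectsRelations I val)
    (v₀ : V) : FundamentalGroup I v₀ →* G where
  toFun := Quotient.lift (fun p => walkWeight val p) fun _ _ h => Homotopic.walkWeight_eq hI h
  map_one' := rfl
  map_mul' := by
    rintro ⟨p⟩ ⟨q⟩
    exact walkWeight_comp val p q

variable {v₀ : V} (t : ∀ x : Quiver.Symmetrify V, Walk (Quiver.Symmetrify.of.obj v₀) x)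

/-- The class of the closed walk at `v₀` obtained from a walk and chosen walks from `v₀` to all
vertices. -/
def loopClass (I : Ideal (PathAlgebra k V))
    (t : ∀ x : Quiver.Symmetrify V, Walk (Quiver.Symmetrify.of.obj v₀) x)
    {x y : Quiver.Symmetrify V} (p : Walk x y) : FundamentalGroup I v₀ :=
  Quotient.mk _ (((t x).comp p).comp (t y).reverse)

variable {t}

theorem loopClass_congr {x y : Quiver.Symmetrify V} {p q : Walk x y} (h : Homotopic I p q) :
    loopClass I t p = loopClass I t q :=
  Quotient.sound (Homotopic.comp _ _ h)

theorem loopClass_comp {x y z : Quiver.Symmetrify V} (p : Walk x y) (q : Walk y z) :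
    loopClass I t (p.comp q) = loopClass I t p * loopClass I t q := by
  refine (Quotient.sound (show Homotopic I _ _ from ?_)).symm
  have h := Homotopic.comp ((t x).comp p) (q.comp (t z).reverse)
    (Homotopic.reverse_comp I (t y))
  simpa only [Quiver.Path.comp_assoc, Quiver.Path.nil_comp, Quiver.Path.comp_nil] using h

theorem loopClass_nil (x : Quiver.Symmetrify V) :
    loopClass I t (Quiver.Path.nil : Walk x x) = 1 := by
  have h := loopClass_comp (I := I) (t := t) (Quiver.Path.nil : Walk x x) Quiver.Path.nil
  rw [Quiver.Path.comp_nil] at h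
  exact (mul_eq_left.mp h.symm)

theorem loopClass_invArrowWalk {x y : V} (α : x ⟶ y) :
    loopClass I t (invArrowWalk α) = (loopClass I t (arrowWalk α))⁻¹ := by
  rw [eq_inv_iff_mul_eq_one, ← loopClass_comp, loopClass_congr (Homotopic.inv_arrow α),
    loopClass_nil]

theorem map_walkWeight_eq_loopClass {val : ∀ x y : V, (x ⟶ y) → G}
    (Ψ : G →* FundamentalGroup I v₀)
    (hΨ : ∀ (x y : V) (α : x ⟶ y), Ψ (val x y α) = loopClass I t (arrowWalk α))
    {x y : Quiver.Symmetrify V} (p : Walk x y) : Ψ (walkWeight val p) = loopClass I t p := by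
  induction p with
  | nil => rw [loopClass_nil]; exact map_one Ψ
  | cons p e ih =>
    have h : loopClass I t (p.cons e) = loopClass I t p * loopClass I t e.toPath :=
      loopClass_comp p e.toPath
    rw [h, walkWeight, map_mul, ih]
    congr 1
    rcases e with α | α
    · exact hΨ _ _ α
    · exact (map_inv Ψ _).trans ((congrArg _ (hΨ _ _ α)).trans
        (loopClass_invArrowWalk (t := t) α).symm)

/-- The fundamental group is `G` as soon as `G` has the universal property of the group generated
by the arrows subject to the relations given by homotopy and by a system of walks `t`. -/
theorem nonempty_mulEquiv_fundamentalGroup {val : ∀ x y : V, (x ⟶ y) → G}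
    (hI : RespectsRelations I val) (ht : t (Quiver.Symmetrify.of.obj v₀) = Quiver.Path.nil)
    (hval : ∀ x, walkWeight val (t x) = 1) (Ψ : G →* FundamentalGroup I v₀)
    (hΨ : ∀ (x y : V) (α : x ⟶ y), Ψ (val x y α) = loopClass I t (arrowWalk α))
    (hext : ∀ θ : G →* G, (∀ (x y : V) (α : x ⟶ y), θ (val x y α) = val x y α) →
      θ = MonoidHom.id G) :
    Nonempty (FundamentalGroup I v₀ ≃* G) := by
  have hrev : ∀ x, walkWeight val (t x).reverse = 1 := fun x => by
    have h := Homotopic.walkWeight_eq hI (Homotopic.comp_reverse I (t x))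
    rwa [walkWeight_comp, hval, one_mul] at h
  refine ⟨MonoidHom.toMulEquiv (FundamentalGroup.weightHom hI v₀) Ψ ?_ (hext _ ?_)⟩
  -- The connecting walk at `v₀` is stationary, so the loop class of a closed walk at `v₀` is its
  -- own class.
  · refine MonoidHom.ext ?_
    rintro ⟨p⟩
    refine (map_walkWeight_eq_loopClass (t := t) Ψ hΨ p).trans ?_
    rw [loopClass, ht]
    simp only [Quiver.Path.reverse, Quiver.Path.comp_nil, Quiver.Path.nil_comp]
    rfl
  -- The connecting walks have weight 1, so the composite endomorphism of `G` fixes the weight of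
  -- every arrow and `hext` applies.
  · intro x y α
    rw [MonoidHom.comp_apply, hΨ]
    refine (walkWeight_comp val _ _).trans ?_
    rw [hrev, walkWeight_comp, hval, walkWeight_arrowWalk, one_mul, mul_one]

/-- The fundamental group does not depend on the base point. -/
theorem nonempty_mulEquiv_fundamentalGroup_of_walk {v₁ : V}
    (c : Walk (Quiver.Symmetrify.of.obj v₁) (Quiver.Symmetrify.of.obj v₀)) :
    Nonempty (FundamentalGroup I v₁ ≃* FundamentalGroup I v₀) := by
  have key : ∀ {a b : V} (c : Walk (Quiver.Symmetrify.of.obj a) (Quiver.Symmetrify.of.obj b)),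
      ∃ f : FundamentalGroup I b →* FundamentalGroup I a, ∀ p : Walk _ _,
        f (Quotient.mk _ p) = Quotient.mk _ ((c.comp p).comp c.reverse) := by
    intro a b c
    refine ⟨MonoidHom.mk' (Quotient.map (fun p => (c.comp p).comp c.reverse)
      fun _ _ h => Homotopic.comp _ _ h) ?_, fun p => rfl⟩
    rintro ⟨p⟩ ⟨q⟩
    refine (Quotient.sound (show Homotopic I _ _ from ?_)).symm
    have h := Homotopic.comp (c.comp p) (q.comp c.reverse) (Homotopic.reverse_comp I c)
    simpa only [Quiver.Path.comp_assoc, Quiver.Path.nil_comp, Quiver.Path.comp_nil] using h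
  obtain ⟨f, hf⟩ := key c
  obtain ⟨g, hg⟩ := key c.reverse
  refine ⟨MonoidHom.toMulEquiv g f ?_ ?_⟩
  · refine MonoidHom.ext ?_
    rintro ⟨p⟩
    change f (g (Quotient.mk _ p)) = Quotient.mk _ p
    rw [hg, hf]
    refine Quotient.sound (show Homotopic I _ _ from ?_)
    have h := (Homotopic.comp_reverse I c).comp_both
      ((Homotopic.refl (I := I) p).comp_both (Homotopic.comp_reverse I c))
    simpa only [Quiver.Path.comp_assoc, Quiver.Path.nil_comp, Quiver.Path.comp_nil,
      Quiver.Path.reverse_reverse] using h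
  · refine MonoidHom.ext ?_
    rintro ⟨p⟩
    change g (f (Quotient.mk _ p)) = Quotient.mk _ p
    rw [hf, hg]
    refine Quotient.sound (show Homotopic I _ _ from ?_)
    have h := (Homotopic.reverse_comp I c).comp_both
      ((Homotopic.refl (I := I) p).comp_both (Homotopic.reverse_comp I c))
    simpa only [Quiver.Path.comp_assoc, Quiver.Path.nil_comp, Quiver.Path.comp_nil,
      Quiver.Path.reverse_reverse] using h

end Walks

/-! ### Morphisms from path algebras and powers of the arrow ideal -/

namespace PathAlgebra

variable {k : Type*} [Field k] {V : Type*} [Quiver V]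

/-- The extension of a function on the paths to a linear map. -/
noncomputable def lift {M : Type*} [AddCommGroup M] [Module k M] (f : TotalPath V → M) :
    PathAlgebra k V →ₗ[k] M :=
  Finsupp.linearCombination k f

theorem lift_ofPath {M : Type*} [AddCommGroup M] [Module k M] (f : TotalPath V → M) {x y : V}
    (p : Quiver.Path x y) : lift f (ofPath p : PathAlgebra k V) = f ⟨x, y, p⟩ :=
  (Finsupp.linearCombination_single k (1 : k) _).trans (one_smul k _)

theorem map_ofPath {W : Type*} [Quiver W] (F : V ⥤q W) {x y : V} (p : Quiver.Path x y) :
    map k F (ofPath p) = ofPath (F.mapPath p) :=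
  Finsupp.mapDomain_single

theorem ofParallel_single {x y : V} (p : Quiver.Path x y) (c : k) :
    ofParallel k x y (Finsupp.single p c) = c • ofPath p := by
  refine Finsupp.mapDomain_single.trans ?_
  refine Eq.trans ?_ (Finsupp.smul_single c _ (1 : k)).symm
  rw [smul_eq_mul, mul_one]

theorem nil_mul_ofPath {x y : V} (p : Quiver.Path x y) :
    (ofPath (Quiver.Path.nil : Quiver.Path x x) * ofPath p : PathAlgebra k V) = ofPath p := by
  rw [ofPath_mul_ofPath_comp, Quiver.Path.nil_comp]

theorem ofPath_mul_nil {x y : V} (p : Quiver.Path x y) :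
    (ofPath p * ofPath (Quiver.Path.nil : Quiver.Path y y) : PathAlgebra k V) = ofPath p :=
  ofPath_mul_ofPath_comp p Quiver.Path.nil

/-- The path algebra is spanned by the paths. -/
theorem induction_on {P : PathAlgebra k V → Prop} (f : PathAlgebra k V) (h0 : P 0)
    (hadd : ∀ f g, P f → P g → P (f + g))
    (hpath : ∀ (c : k) {x y : V} (p : Quiver.Path x y), P (c • ofPath p)) : P f := by
  refine Finsupp.induction_linear (motive := P) f h0 hadd fun t c => ?_
  have h := hpath c t.path
  have h' : (c • ofPath t.path : PathAlgebra k V) = Finsupp.single t c :=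
    (Finsupp.smul_single c _ (1 : k)).trans (by rw [smul_eq_mul, mul_one])
  rwa [h'] at h

/-! ### Algebra morphisms out of a path algebra -/

section Substitution

variable {R : Type*} [Ring R] [Algebra k R] (e : V → R) (E : ∀ x y : V, (x ⟶ y) → R)

/-- The image of a path under a substitution of the stationary paths and the arrows. -/
def substPath {x : V} : ∀ {y : V}, Quiver.Path x y → R
  | _, Quiver.Path.nil => e x
  | _, Quiver.Path.cons (b := y) (c := z) p α => substPath p * E y z α

variable {e E}

theorem substPath_mul_right (he : ∀ x, e x * e x = e x)
    (hE : ∀ (x y : V) (α : x ⟶ y), E x y α * e y = E x y α) {x y : V} (p : Quiver.Path x y) :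
    substPath e E p * e y = substPath e E p := by
  cases p with
  | nil => exact he x
  | cons p α => rw [substPath, mul_assoc, hE]

theorem substPath_mul_left (he : ∀ x, e x * e x = e x) {x y : V} (p : Quiver.Path x y) :
    e x * substPath e E p = substPath e E p := by
  induction p with
  | nil => exact he x
  | cons p α ih => rw [substPath, ← mul_assoc, ih]

/-- Absorption on the right suffices: the image of a path begins with `e x` by construction, and the
idempotent at the junction is absorbed by the first factor. -/
theorem substPath_comp (he : ∀ x, e x * e x = e x)
    (hE : ∀ (x y : V) (α : x ⟶ y), E x y α * e y = E x y α) {x y z : V} (p : Quiver.Path x y)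
    (q : Quiver.Path y z) : substPath e E (p.comp q) = substPath e E p * substPath e E q := by
  induction q with
  | nil => exact (substPath_mul_right he hE p).symm
  | cons q α ih => rw [Quiver.Path.comp_cons, substPath, substPath, ih, mul_assoc]

/-- The morphism of algebras given by a substitution of the stationary paths and the arrows. -/
noncomputable def substHom [Fintype V] (he : ∀ x, e x * e x = e x)
    (he' : ∀ x y, x ≠ y → e x * e y = 0)
    (he1 : ∑ x, e x = 1) (hE : ∀ (x y : V) (α : x ⟶ y), E x y α * e y = E x y α) :
    PathAlgebra k V →ₐ[k] R :=
  AlgHom.ofLinearMap (lift fun t : TotalPath V => substPath e E t.path)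
    (by
      rw [one_def, map_sum, ← he1]
      exact Finset.sum_congr rfl fun x _ => lift_ofPath (k := k) _ Quiver.Path.nil)
    (by
      intro f g
      have h : (mulHom (k := k) (V := V)).compr₂
          (lift fun t : TotalPath V => substPath e E t.path) =
          (LinearMap.mul k R).compl₁₂ (lift fun t : TotalPath V => substPath e E t.path)
            (lift fun t : TotalPath V => substPath e E t.path) := by
        refine lhom_ext fun x y p => lhom_ext fun x' y' q => ?_
        change lift (fun t => substPath e E t.path) (ofPath p * ofPath q : PathAlgebra k V) =
          lift (fun t => substPath e E t.path) (ofPath p : PathAlgebra k V) *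
            lift (fun t => substPath e E t.path) (ofPath q : PathAlgebra k V)
        rw [lift_ofPath, lift_ofPath]
        by_cases hxy : x' = y
        · subst hxy
          rw [ofPath_mul_ofPath_comp, lift_ofPath]
          exact substPath_comp he hE p q
        · rw [ofPath_mul_ofPath_ne _ _ hxy, map_zero]
          change 0 = substPath e E p * substPath e E q
          -- Inserting the end idempotents between the two factors exhibits the vanishing product `e
          -- y * e x'`.
          rw [← substPath_mul_right he hE p, ← substPath_mul_left (E := E) he q, mul_assoc,
            ← mul_assoc (e y), he' y x' (Ne.symm hxy), zero_mul, mul_zero]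
      exact congrArg (fun T => T f g) h)

theorem substHom_ofPath [Fintype V] (he : ∀ x, e x * e x = e x) (he' : ∀ x y, x ≠ y → e x * e y = 0)
    (he1 : ∑ x, e x = 1) (hE : ∀ (x y : V) (α : x ⟶ y), E x y α * e y = E x y α)
    {x y : V} (p : Quiver.Path x y) :
    substHom (k := k) he he' he1 hE (ofPath p) = substPath e E p :=
  lift_ofPath _ _

end Substitution

/-- The span of the paths of length at least `n`. -/
noncomputable def longPaths (k : Type*) [Field k] (V : Type*) [Quiver V] (n : ℕ) :
    Submodule k (PathAlgebra k V) :=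
  Submodule.span k {f | ∃ (x y : V) (p : Quiver.Path x y), n ≤ p.length ∧ f = ofPath p}

theorem ofPath_mem_longPaths {n : ℕ} {x y : V} {p : Quiver.Path x y} (h : n ≤ p.length) :
    (ofPath p : PathAlgebra k V) ∈ longPaths k V n :=
  Submodule.subset_span ⟨x, y, p, h, rfl⟩

theorem longPaths_zero : longPaths k V 0 = ⊤ := by
  refine eq_top_iff.mpr fun f _ => ?_
  refine induction_on (P := fun f => f ∈ longPaths k V 0) f (Submodule.zero_mem _)
    (fun f g hf hg => Submodule.add_mem _ hf hg) fun c x y p => ?_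
  exact Submodule.smul_mem _ _ (ofPath_mem_longPaths (Nat.zero_le _))

theorem mul_mem_longPaths {m n : ℕ} {f g : PathAlgebra k V} (hf : f ∈ longPaths k V m)
    (hg : g ∈ longPaths k V n) : f * g ∈ longPaths k V (m + n) := by
  have h : longPaths k V m ≤
      (longPaths k V (m + n)).comap ((mulHom (k := k) (V := V)).flip g) := by
    refine Submodule.span_le.mpr ?_
    rintro _ ⟨x, y, p, hp, rfl⟩
    have h' : longPaths k V n ≤
        (longPaths k V (m + n)).comap (mulHom (k := k) (V := V) (ofPath p)) := by
      refine Submodule.span_le.mpr ?_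
      rintro _ ⟨x', y', q, hq, rfl⟩
      change ofPath p * ofPath q ∈ longPaths k V (m + n)
      by_cases hxy : x' = y
      · subst hxy
        rw [ofPath_mul_ofPath_comp]
        exact ofPath_mem_longPaths (by rw [Quiver.Path.length_comp]; omega)
      · rw [ofPath_mul_ofPath_ne _ _ hxy]
        exact Submodule.zero_mem _
    exact h' hg
  exact h hf

variable [Fintype V]

/-- A subspace is a left ideal if it is stable under multiplication by paths. -/
theorem mul_mem_of_forall_ofPath {S : Submodule k (PathAlgebra k V)}
    (h : ∀ f ∈ S, ∀ (x y : V) (p : Quiver.Path x y), ofPath p * f ∈ S)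
    (g : PathAlgebra k V) {f : PathAlgebra k V} (hf : f ∈ S) : g * f ∈ S := by
  refine induction_on (P := fun g => g * f ∈ S) g ?_ ?_ ?_
  · rw [zero_mul]; exact S.zero_mem
  · intro a b ha hb; rw [add_mul]; exact S.add_mem ha hb
  · intro c x y p; rw [smul_mul_assoc]; exact S.smul_mem _ (h f hf x y p)

/-- A subspace is a right ideal if it is stable under multiplication by paths. -/
theorem mul_mem_of_forall_ofPath' {S : Submodule k (PathAlgebra k V)}
    (h : ∀ f ∈ S, ∀ (x y : V) (p : Quiver.Path x y), f * ofPath p ∈ S)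
    {f : PathAlgebra k V} (hf : f ∈ S) (g : PathAlgebra k V) : f * g ∈ S := by
  refine induction_on (P := fun g => f * g ∈ S) g ?_ ?_ ?_
  · rw [mul_zero]; exact S.zero_mem
  · intro a b ha hb; rw [mul_add]; exact S.add_mem ha hb
  · intro c x y p; rw [mul_smul_comm]; exact S.smul_mem _ (h f hf x y p)

theorem mem_longPaths_of_mem_arrowIdeal {f : PathAlgebra k V} (hf : f ∈ arrowIdeal k V) :
    f ∈ longPaths k V 1 := by
  have hf' : f ∈ TwoSidedIdeal.span
      {f : PathAlgebra k V | ∃ (x y : V) (α : x ⟶ y), f = ofPath α.toPath} := hf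
  clear hf
  induction hf' using TwoSidedIdeal.span_induction with
  | mem f hf =>
    obtain ⟨x, y, α, rfl⟩ := hf
    exact ofPath_mem_longPaths (p := α.toPath) le_rfl
  | zero => exact Submodule.zero_mem _
  | add f g _ _ hf hg => exact Submodule.add_mem _ hf hg
  | neg f _ hf => exact Submodule.neg_mem _ hf
  | left_absorb a f _ hf =>
    have ha : a ∈ longPaths k V 0 := by rw [longPaths_zero]; trivial
    have h := mul_mem_longPaths ha hf
    rwa [zero_add] at h
  | right_absorb a f _ hf =>
    have ha : a ∈ longPaths k V 0 := by rw [longPaths_zero]; trivial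
    have h := mul_mem_longPaths hf ha
    rwa [add_zero] at h

/-- This shows that a power of the arrow ideal vanishes once the lengths of paths are bounded. -/
theorem mem_longPaths_of_mem_arrowIdeal_pow (n : ℕ) {f : PathAlgebra k V}
    (hf : f ∈ arrowIdeal k V ^ n) : f ∈ longPaths k V n := by
  induction n generalizing f with
  | zero => rw [longPaths_zero]; trivial
  | succ n ih =>
    rw [Submodule.pow_succ] at hf
    refine Submodule.smul_induction_on hf (fun a ha b hb => ?_) fun a b => Submodule.add_mem _
    exact mul_mem_longPaths (ih ha) (mem_longPaths_of_mem_arrowIdeal hb)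

theorem ofPath_toPath_mem_arrowIdeal {x y : V} (α : x ⟶ y) :
    (ofPath α.toPath : PathAlgebra k V) ∈ arrowIdeal k V :=
  TwoSidedIdeal.subset_span ⟨x, y, α, rfl⟩

end PathAlgebra

/-! ### Ideals given by labels on the paths -/

section Labels

variable {k : Type*} [Field k] {V : Type*} [Quiver V] {X : Type*}

/-- The linear map sending each path to its label, and the paths without a label to `0`. -/
noncomputable def labelMap (k : Type*) [Field k] (lab : TotalPath V → Option X) :
    PathAlgebra k V →ₗ[k] (X →₀ k) :=
  PathAlgebra.lift fun t => (lab t).elim 0 fun ξ => Finsupp.single ξ 1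

variable {lab : TotalPath V → Option X}

theorem labelMap_ofPath {x y : V} (p : Quiver.Path x y) :
    labelMap k lab (PathAlgebra.ofPath p) =
      (lab ⟨x, y, p⟩).elim 0 fun ξ => Finsupp.single ξ 1 :=
  PathAlgebra.lift_ofPath _ _

/-- A linear map whose values on the paths only depend on the labels vanishes on the kernel of
`labelMap`. -/
theorem map_eq_zero_of_labelMap_eq_zero {M : Type*} [AddCommGroup M] [Module k M]
    (T : PathAlgebra k V →ₗ[k] M) (Θ : X → M)
    (hT : ∀ (x y : V) (p : Quiver.Path x y),
      T (PathAlgebra.ofPath p) = (lab ⟨x, y, p⟩).elim 0 Θ)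
    {f : PathAlgebra k V} (hf : labelMap k lab f = 0) : T f = 0 := by
  have h : T = (Finsupp.linearCombination k Θ).comp (labelMap k lab) := by
    refine PathAlgebra.lhom_ext fun x y p => ?_
    rw [hT, LinearMap.comp_apply, labelMap_ofPath]
    cases lab ⟨x, y, p⟩ with
    | none => exact (map_zero _).symm
    | some ξ => exact ((Finsupp.linearCombination_single k 1 ξ).trans (one_smul k _)).symm
  rw [h, LinearMap.comp_apply, hf, map_zero]

theorem labelMap_ofParallel_single {x y : V} (p : Quiver.Path x y) (c : k) :
    labelMap k lab (PathAlgebra.ofParallel k x y (Finsupp.single p c)) =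
      (lab ⟨x, y, p⟩).elim 0 fun ξ => Finsupp.single ξ c := by
  rw [PathAlgebra.ofParallel_single, map_smul, labelMap_ofPath]
  cases lab ⟨x, y, p⟩ with
  | none => exact smul_zero c
  | some ξ => exact (Finsupp.smul_single c ξ 1).trans (by rw [smul_eq_mul, mul_one]; rfl)

variable [Fintype V] {I : Ideal (PathAlgebra k V)}

/-- All paths of a minimal relation have the same label. -/
theorem IsMinimalRelation.exists_label (hI : ∀ f, f ∈ I ↔ labelMap k lab f = 0) {x y : V}
    {ρ : Quiver.Path x y →₀ k} (hρ : IsMinimalRelation I ρ) :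
    ∃ ξ, ∀ p ∈ ρ.support, lab ⟨x, y, p⟩ = some ξ := by
  classical
  obtain ⟨p, hp⟩ : ρ.support.Nonempty := Finset.card_pos.mp (by have := hρ.two_le; omega)
  cases hlab : lab ⟨x, y, p⟩ with
  | none =>
    -- An unlabelled path lies in `I` by itself and would be a proper partial sum.
    refine absurd ((hI _).mpr ?_) (hρ.partial_notMem {p} (Finset.singleton_nonempty p) ?_)
    · rw [Finset.sum_singleton, labelMap_ofParallel_single, hlab]; rfl
    · refine Finset.ssubset_iff_subset_ne.mpr ⟨Finset.singleton_subset_iff.mpr hp, fun h => ?_⟩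
      have h2 := hρ.two_le
      rw [← h, Finset.card_singleton] at h2
      omega
  | some ξ =>
    refine ⟨ξ, ?_⟩
    -- The coefficients over `T` add up to the coefficient of `ξ` in the image of `ρ`, which is 0.
    -- So this partial sum lies in `I`, and minimality makes it all of `ρ`.
    set T := ρ.support.filter fun q => lab ⟨x, y, q⟩ = some ξ with hT
    have hsum : ∑ q ∈ T, ρ q = 0 := by
      have h0 := (hI _).mp hρ.mem
      rw [← Finsupp.sum_single ρ, Finsupp.sum, map_sum, map_sum] at h0
      have h1 := DFunLike.congr_fun h0 ξ
      rw [Finsupp.finsetSum_apply] at h1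
      rw [hT, Finset.sum_filter]
      refine Eq.trans (Finset.sum_congr rfl fun q _ => ?_) h1
      rw [labelMap_ofParallel_single]
      cases lab ⟨x, y, q⟩ with
      | none => simp
      | some η => simp [Finsupp.single_apply]
    have hmem : PathAlgebra.ofParallel k x y (∑ q ∈ T, Finsupp.single q (ρ q)) ∈ I := by
      have h : ∀ q ∈ T, labelMap k lab (PathAlgebra.ofParallel k x y (Finsupp.single q (ρ q))) =
          Finsupp.single ξ (ρ q) := fun q hq => by
        rw [labelMap_ofParallel_single, (Finset.mem_filter.mp hq).2]
        rfl
      rw [hI, map_sum, map_sum, Finset.sum_congr rfl h, ← Finsupp.single_finsetSum, hsum,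
        Finsupp.single_zero]
    have hTp : T.Nonempty := ⟨p, Finset.mem_filter.mpr ⟨hp, hlab⟩⟩
    have hTeq : T = ρ.support := by
      by_contra hne
      exact hρ.partial_notMem T hTp
        (Finset.ssubset_iff_subset_ne.mpr ⟨Finset.filter_subset _ _, hne⟩) hmem
    intro q hq
    rw [← hTeq] at hq
    exact (Finset.mem_filter.mp hq).2

/-- Two parallel paths with the same label are homotopic. -/
theorem homotopic_of_label_eq (hI : ∀ f, f ∈ I ↔ labelMap k lab f = 0) {x y : V}
    {p q : Quiver.Path x y} {ξ : X} (hp : lab ⟨x, y, p⟩ = some ξ) (hq : lab ⟨x, y, q⟩ = some ξ) :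
    Homotopic I (toWalk p) (toWalk q) := by
  classical
  by_cases hpq : p = q
  · rw [hpq]; exact Homotopic.refl _
  -- The proper nonempty parts of `p - q` are multiples of single labelled paths, which `labelMap`
  -- does not kill.
  set ρ : Quiver.Path x y →₀ k := Finsupp.single p 1 - Finsupp.single q 1 with hρ
  have hρp : ρ p = 1 := by simp [hρ, Ne.symm hpq]
  have hρq : ρ q = -1 := by simp [hρ, hpq]
  have hsupp : ρ.support = {p, q} := by
    ext r
    by_cases h1 : p = r
    · subst h1; simp [hρp]
    · by_cases h2 : q = r
      · subst h2; simp [hρq]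
      · simp [hρ, Ne.symm h1, Ne.symm h2]
  have hone : ∀ r ∈ ({p, q} : Finset (Quiver.Path x y)), lab ⟨x, y, r⟩ = some ξ ∧ ρ r ≠ 0 := by
    intro r hr
    rcases Finset.mem_insert.mp hr with rfl | hr
    · exact ⟨hp, by rw [hρp]; exact one_ne_zero⟩
    · rw [Finset.mem_singleton] at hr
      subst hr
      exact ⟨hq, by rw [hρq]; exact neg_ne_zero.mpr one_ne_zero⟩
  refine Homotopic.minimal ρ ⟨?_, ?_, ?_⟩ p q (by simp [hsupp]) (by simp [hsupp])
  · rw [hI, hρ, map_sub, map_sub, labelMap_ofParallel_single, labelMap_ofParallel_single, hp, hq]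
    exact sub_self _
  · rw [hsupp, Finset.card_pair hpq]
  · intro T hT hTs hmem
    have hcard := Finset.card_lt_card hTs
    rw [hsupp] at hTs
    rw [hsupp, Finset.card_pair hpq] at hcard
    obtain ⟨r, rfl⟩ := Finset.card_eq_one.mp
      (le_antisymm (Nat.lt_succ_iff.mp hcard) (Finset.card_pos.mpr hT))
    have hr := hone r (hTs.1 (Finset.mem_singleton_self r))
    rw [Finset.sum_singleton, hI, labelMap_ofParallel_single, hr.1] at hmem
    exact hr.2 (Finsupp.single_eq_zero.mp hmem)

end Labels

/-! ### Star quivers -/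

/-- The vertices of the star quiver with rays indexed by `J`: the ray `j` consists of the arrows
`A j` from `center` to `mid j` followed by the arrows `P j` from `mid j` to `fin j`. -/
inductive Star {J : Type} (A P : J → Type) : Type
  | center : Star A P
  | mid (j : J) : Star A P
  | fin (j : J) : Star A P

/-- The arrows of the star quiver. -/
inductive StarHom {J : Type} (A P : J → Type) : Star A P → Star A P → Type
  | fst {j : J} (a : A j) : StarHom A P Star.center (Star.mid j)
  | snd {j : J} (p : P j) : StarHom A P (Star.mid j) (Star.fin j)

namespace Star

variable {J : Type} {A P : J → Type}

instance : Quiver (Star A P) := ⟨StarHom A P⟩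

/-- The arrow `a` of the first layer. -/
def fst {j : J} (a : A j) : (center : Star A P) ⟶ mid j := StarHom.fst a

/-- The arrow `p` of the second layer. -/
def snd {j : J} (p : P j) : (mid j : Star A P) ⟶ fin j := StarHom.snd p

/-- The path of length two consisting of the arrows `a` and `p`. -/
def two {j : J} (a : A j) (p : P j) : Quiver.Path (center : Star A P) (fin j) :=
  (fst a).toPath.comp (snd p).toPath

theorem path_cases {motive : ∀ {x y : Star A P}, Quiver.Path x y → Prop}
    (nil : ∀ x : Star A P, motive (Quiver.Path.nil : Quiver.Path x x))
    (fst : ∀ {j : J} (a : A j), motive (fst a).toPath)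
    (snd : ∀ {j : J} (p : P j), motive (snd p).toPath)
    (two : ∀ {j : J} (a : A j) (p : P j), motive (two a p)) :
    ∀ {x y : Star A P} (p : Quiver.Path x y), motive p
  | _, _, .nil => nil _
  | _, _, .cons .nil (StarHom.fst a) => fst a
  | _, _, .cons .nil (StarHom.snd p) => snd p
  | _, _, .cons (.cons .nil (StarHom.fst a)) (StarHom.snd p) => two a p

/-- The labels of the paths: the paths of length at most one are their own labels. -/
def label {C : J → Type} (lab : ∀ j, A j → P j → Option (C j)) :
    TotalPath (Star A P) → Option (TotalPath (Star A P) ⊕ Σ j, C j)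
  | ⟨x, _, .nil⟩ => some (Sum.inl ⟨x, x, .nil⟩)
  | ⟨_, _, .cons .nil (StarHom.fst a)⟩ => some (Sum.inl ⟨_, _, (fst a).toPath⟩)
  | ⟨_, _, .cons .nil (StarHom.snd p)⟩ => some (Sum.inl ⟨_, _, (snd p).toPath⟩)
  | ⟨_, _, .cons (.cons .nil (StarHom.fst a)) (StarHom.snd p)⟩ =>
    (lab _ a p).map fun c => Sum.inr ⟨_, c⟩

theorem label_two {C : J → Type} (lab : ∀ j, A j → P j → Option (C j)) {j : J} (a : A j)
    (p : P j) : label lab ⟨center, fin j, two a p⟩ = (lab j a p).map fun c => Sum.inr ⟨j, c⟩ :=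
  rfl

/-! ### Finiteness, acyclicity and connectedness of stars -/

section Shape

instance [Finite J] : Finite (Star A P) :=
  Finite.of_injective
    (fun x : Star A P => match x with
      | center => (none : Option (J ⊕ J))
      | mid j => some (Sum.inl j)
      | fin j => some (Sum.inr j))
    (by rintro (_ | i | i) (_ | j | j) h <;> simp_all)

noncomputable instance [Finite J] : Fintype (Star A P) := Fintype.ofFinite _

instance [Finite J] [∀ j, Finite (A j)] [∀ j, Finite (P j)] (x y : Star A P) :
    Finite (x ⟶ y) :=
  Finite.of_injective
    (fun α : StarHom A P x y => match α with
      | StarHom.fst a => (Sum.inl ⟨_, a⟩ : (Σ j, A j) ⊕ Σ j, P j)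
      | StarHom.snd p => Sum.inr ⟨_, p⟩)
    (by
      intro (α : StarHom A P x y) (β : StarHom A P x y) h
      cases α <;> cases β <;> simp_all)

theorem isAcyclic : IsAcyclic (Star A P) := by
  intro x p
  have h : ∀ {x y : Star A P} (p : Quiver.Path x y), x = y → p.length = 0 := fun p =>
    path_cases (motive := fun {x y} p => x = y → p.length = 0) (fun _ _ => rfl) (fun _ => nofun)
      (fun _ => nofun) (fun _ _ => nofun) p
  exact Quiver.Path.eq_nil_of_length_zero p (h p rfl)

theorem length_le_two {x y : Star A P} (p : Quiver.Path x y) : p.length ≤ 2 := by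
  refine path_cases (motive := fun p => p.length ≤ 2) (fun _ => Nat.zero_le _)
    (fun _ => by simp) (fun _ => by simp)
    (fun _ _ => le_rfl) p

variable (a₀ : ∀ j, A j) (p₀ : ∀ j, P j)

/-- The walk from the center to a vertex along the base arrows. -/
def baseWalk : ∀ x : Star A P,
    Walk (Quiver.Symmetrify.of.obj (center : Star A P)) (Quiver.Symmetrify.of.obj x)
  | center => Quiver.Path.nil
  | mid j => arrowWalk (fst (a₀ j))
  | fin j => (arrowWalk (fst (a₀ j))).comp (arrowWalk (snd (p₀ j)))

/-- The star quiver as a finite connected quiver. -/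
noncomputable abbrev toFinConnQuiver [Finite J] [∀ j, Finite (A j)] [∀ j, Finite (P j)]
    (a₀ : ∀ j, A j) (p₀ : ∀ j, P j) : FinConnQuiver where
  Vert := Star A P
  nonempty := ⟨center⟩
  connected x y := ⟨(baseWalk a₀ p₀ x).reverse.comp (baseWalk a₀ p₀ y)⟩

end Shape

/-! ### The admissible ideal of a labelling -/

section Ideal

variable {k : Type*} [Field k] {C : J → Type} {lab lab' : ∀ j, A j → P j → Option (C j)}

theorem labelMap_two {j : J} (a : A j) (p : P j) :
    labelMap k (label lab) (PathAlgebra.ofPath (two a p)) =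
      (lab j a p).elim 0 fun c => Finsupp.single (Sum.inr ⟨j, c⟩) 1 := by
  refine (labelMap_ofPath _).trans ?_
  rw [label_two]
  cases lab j a p <;> rfl

/-- A linear map whose values on the paths of length two only depend on the labels vanishes on the
kernel of `labelMap`. -/
theorem map_eq_zero {M : Type*} [AddCommGroup M] [Module k M]
    (T : PathAlgebra k (Star A P) →ₗ[k] M) (Θ : ∀ j, C j → M)
    (hT : ∀ (j : J) (a : A j) (p : P j),
      T (PathAlgebra.ofPath (two a p)) = (lab j a p).elim 0 (Θ j))
    {f : PathAlgebra k (Star A P)} (hf : labelMap k (label lab) f = 0) : T f = 0 := by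
  -- A path of length at most one is its own label, so the value of `T` on it imposes no condition.
  refine map_eq_zero_of_labelMap_eq_zero T
    (Sum.elim (fun t => T (PathAlgebra.ofPath t.path)) fun c => Θ c.1 c.2) ?_ hf
  intro x y p
  refine path_cases (motive := fun {x y} p => T (PathAlgebra.ofPath p) =
    (label lab ⟨x, y, p⟩).elim 0
      (Sum.elim (fun t => T (PathAlgebra.ofPath t.path)) fun c => Θ c.1 c.2))
    (fun _ => rfl) (fun _ => rfl) (fun _ => rfl) (fun {j} a p => ?_) p
  rw [hT]
  rw [label_two]
  cases lab j a p <;> rfl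

/-- Elements of the kernel are combinations of paths of length two, all starting at the centre. The
only path ending there is stationary; every other left factor gives 0. -/
theorem labelMap_ofPath_mul {f : PathAlgebra k (Star A P)} (hf : labelMap k (label lab) f = 0)
    {x y : Star A P} (r : Quiver.Path x y) :
    labelMap k (label lab) (PathAlgebra.ofPath r * f) = 0 := by
  have hzero : ∀ {x y : Star A P} (r : Quiver.Path x y), center ≠ y →
      labelMap k (label lab) (PathAlgebra.ofPath r * f) = 0 := by
    intro x y r hy
    rw [PathAlgebra.mul_def]
    refine map_eq_zero (lab := lab) ((labelMap k (label lab)).comp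
      (PathAlgebra.mulHom (PathAlgebra.ofPath r))) (fun _ _ => 0) (fun j a p => ?_) hf
    rw [LinearMap.comp_apply, ← PathAlgebra.mul_def,
      PathAlgebra.ofPath_mul_ofPath_ne _ _ hy, map_zero]
    cases lab j a p <;> rfl
  refine path_cases (motive := fun r => labelMap k (label lab) (PathAlgebra.ofPath r * f) = 0)
    (fun x => ?_) (fun a => ?_) (fun p => ?_) (fun a p => ?_) r
  rotate_left
  · exact hzero _ nofun
  · exact hzero _ nofun
  · exact hzero _ nofun
  by_cases hx : center = x
  · subst hx
    rw [PathAlgebra.mul_def]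
    refine map_eq_zero (lab := lab) ((labelMap k (label lab)).comp
      (PathAlgebra.mulHom
        (PathAlgebra.ofPath (Quiver.Path.nil : Quiver.Path (center : Star A P) center))))
      (fun j c => Finsupp.single (Sum.inr ⟨j, c⟩) 1) (fun j a p => ?_) hf
    rw [LinearMap.comp_apply, ← PathAlgebra.mul_def,
      PathAlgebra.ofPath_mul_ofPath_comp, Quiver.Path.nil_comp, labelMap_two]
  · exact hzero _ hx

theorem labelMap_mul_ofPath {f : PathAlgebra k (Star A P)} (hf : labelMap k (label lab) f = 0)
    {x y : Star A P} (r : Quiver.Path x y) :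
    labelMap k (label lab) (f * PathAlgebra.ofPath r) = 0 := by
  classical
  have hzero : ∀ {x y : Star A P} (r : Quiver.Path x y), (∀ j, x ≠ fin j) →
      labelMap k (label lab) (f * PathAlgebra.ofPath r) = 0 := by
    intro x y r hx
    rw [PathAlgebra.mul_def]
    refine map_eq_zero (lab := lab) ((labelMap k (label lab)).comp
      (PathAlgebra.mulHom.flip (PathAlgebra.ofPath r))) (fun _ _ => 0) (fun j a p => ?_) hf
    rw [LinearMap.comp_apply, LinearMap.flip_apply, ← PathAlgebra.mul_def,
      PathAlgebra.ofPath_mul_ofPath_ne _ _ (hx j), map_zero]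
    cases lab j a p <;> rfl
  refine path_cases (motive := fun r => labelMap k (label lab) (f * PathAlgebra.ofPath r) = 0)
    (fun x => ?_) (fun a => ?_) (fun p => ?_) (fun a p => ?_) r
  rotate_left
  · exact hzero _ nofun
  · exact hzero _ nofun
  · exact hzero _ nofun
  rw [PathAlgebra.mul_def]
  refine map_eq_zero (lab := lab) ((labelMap k (label lab)).comp
    (PathAlgebra.mulHom.flip (PathAlgebra.ofPath (Quiver.Path.nil : Quiver.Path x x))))
    -- Unlike the sources, the targets vary with the ray: the stationary path at `fin j` cuts out
    -- the part of `f` in the ray `j`.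
    (fun j c => if x = fin j then Finsupp.single (Sum.inr ⟨j, c⟩) 1 else 0) (fun j a p => ?_) hf
  rw [LinearMap.comp_apply, LinearMap.flip_apply, ← PathAlgebra.mul_def]
  by_cases hx : x = fin j
  · subst hx
    rw [PathAlgebra.ofPath_mul_ofPath_comp, Quiver.Path.comp_nil, labelMap_two]
    simp only [if_true]
  · rw [PathAlgebra.ofPath_mul_ofPath_ne _ _ hx, map_zero]
    simp only [hx, if_false]
    cases lab j a p <;> rfl

variable [Finite J]

/-- The ideal of the linear combinations of paths of length two for which the sum of the
coefficients of the paths with a given label vanishes. -/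
noncomputable def labelIdeal (k : Type*) [Field k] (lab : ∀ j, A j → P j → Option (C j)) :
    Ideal (PathAlgebra k (Star A P)) where
  carrier := {f | labelMap k (label lab) f = 0}
  zero_mem' := map_zero _
  add_mem' := fun {f g} hf hg => by
    change labelMap k (label lab) (f + g) = 0
    rw [map_add, hf, hg, add_zero]
  smul_mem' := fun g _ hf =>
    PathAlgebra.mul_mem_of_forall_ofPath (S := LinearMap.ker (labelMap k (label lab)))
      (fun _ hf _ _ r => labelMap_ofPath_mul hf r) g hf

theorem mem_labelIdeal {f : PathAlgebra k (Star A P)} :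
    f ∈ labelIdeal k lab ↔ labelMap k (label lab) f = 0 := Iff.rfl

instance : (labelIdeal k lab).IsTwoSided where
  mul_mem_of_left g hf :=
    PathAlgebra.mul_mem_of_forall_ofPath' (S := LinearMap.ker (labelMap k (label lab)))
      (fun _ hf _ _ r => labelMap_mul_ofPath hf r) hf g

theorem isAdmissible_labelIdeal : IsAdmissible k (labelIdeal k lab) where
  isTwoSided := inferInstance
  exists_pow_le := by
    -- No path of a star has length three.
    refine ⟨3, by norm_num, fun f hf => ?_⟩
    have h : f ∈ PathAlgebra.longPaths k (Star A P) 3 :=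
      PathAlgebra.mem_longPaths_of_mem_arrowIdeal_pow 3 hf
    have hbot : PathAlgebra.longPaths k (Star A P) 3 ≤ ⊥ := by
      refine Submodule.span_le.mpr ?_
      rintro _ ⟨x, y, p, hp, -⟩
      have := length_le_two p
      omega
    rw [(Submodule.mem_bot k).mp (hbot h)]
    exact Ideal.zero_mem _
  le_sq := by
    intro f hf
    have h : ((arrowIdeal k (Star A P) ^ 2).restrictScalars k).mkQ f = 0 := by
      refine map_eq_zero (lab := lab) _ (fun _ _ => 0) (fun j a p => ?_) hf
      have h2 : ((arrowIdeal k (Star A P) ^ 2).restrictScalars k).mkQ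
          (PathAlgebra.ofPath (two a p)) = 0 := by
        refine (Submodule.Quotient.mk_eq_zero _).mpr ?_
        rw [Submodule.restrictScalars_mem, Submodule.pow_succ, Submodule.pow_one, two,
          ← PathAlgebra.ofPath_mul_ofPath_comp]
        exact Ideal.mul_mem_mul (PathAlgebra.ofPath_toPath_mem_arrowIdeal _)
          (PathAlgebra.ofPath_toPath_mem_arrowIdeal _)
      rw [h2]
      cases lab j a p <;> rfl
    exact (Submodule.Quotient.mk_eq_zero _).mp h

end Ideal

/-! ### The fundamental group of a labelled star -/

section FundamentalGroup

variable {C : J → Type} {G : Type*} [Group G]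

/-- The products of the weights of the arrows of a path of length two only depend on the label. -/
def Compatible (lab : ∀ j, A j → P j → Option (C j)) {K : Type*} [Group K] (f : ∀ j, A j → K)
    (g : ∀ j, P j → K) : Prop :=
  ∀ (j : J) (a a' : A j) (p p' : P j) (c : C j), lab j a p = some c → lab j a' p' = some c →
    f j a * g j p = f j a' * g j p'

/-- `G` is the group generated by the arrows, subject to the relations saying that the base arrows
are trivial and that paths of length two with the same label agree. -/
structure IsLabelGroup (lab : ∀ j, A j → P j → Option (C j)) (a₀ : ∀ j, A j) (p₀ : ∀ j, P j)
    (f : ∀ j, A j → G) (g : ∀ j, P j → G) : Prop where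
  base_fst : ∀ j, f j (a₀ j) = 1
  base_snd : ∀ j, g j (p₀ j) = 1
  compatible : Compatible lab f g
  exists_hom : ∀ {K : Type} [Group K] (f' : ∀ j, A j → K) (g' : ∀ j, P j → K),
    (∀ j, f' j (a₀ j) = 1) → (∀ j, g' j (p₀ j) = 1) → Compatible lab f' g' →
      ∃ ψ : G →* K, (∀ j a, ψ (f j a) = f' j a) ∧ ∀ j p, ψ (g j p) = g' j p
  hom_ext : ∀ θ : G →* G, (∀ j a, θ (f j a) = f j a) → (∀ j p, θ (g j p) = g j p) →
    θ = MonoidHom.id G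

/-- The weights of the arrows given by weights on the two layers. -/
def arrowVal (f : ∀ j, A j → G) (g : ∀ j, P j → G) : ∀ x y : Star A P, (x ⟶ y) → G
  | _, _, StarHom.fst a => f _ a
  | _, _, StarHom.snd p => g _ p

theorem walkWeight_two (f : ∀ j, A j → G) (g : ∀ j, P j → G) {j : J} (a : A j) (p : P j) :
    walkWeight (arrowVal f g) (toWalk (two a p)) = f j a * g j p :=
  congrArg (· * g j p) (one_mul (f j a))

theorem eq_of_label_eq_inl {lab : ∀ j, A j → P j → Option (C j)} {t : TotalPath (Star A P)}
    {x y : Star A P} (p : Quiver.Path x y) :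
    label lab ⟨x, y, p⟩ = some (Sum.inl t) → (⟨x, y, p⟩ : TotalPath (Star A P)) = t := by
  refine path_cases (motive := fun {x y} p => label lab ⟨x, y, p⟩ = some (Sum.inl t) →
    (⟨x, y, p⟩ : TotalPath (Star A P)) = t) ?_ ?_ ?_ ?_ p
  · intro x h; exact Sum.inl_injective (Option.some_injective _ h)
  · intro j a h; exact Sum.inl_injective (Option.some_injective _ h)
  · intro j p h; exact Sum.inl_injective (Option.some_injective _ h)
  · intro j a p h
    change (lab j a p).map _ = _ at h
    simp at h

theorem eq_of_label_eq_inr {lab : ∀ j, A j → P j → Option (C j)} {j : J} {c : C j}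
    {x y : Star A P} (p : Quiver.Path x y) :
    label lab ⟨x, y, p⟩ = some (Sum.inr ⟨j, c⟩) → ∃ (a : A j) (q : P j),
      lab j a q = some c ∧ (⟨x, y, p⟩ : TotalPath (Star A P)) = ⟨_, _, two a q⟩ := by
  refine path_cases (motive := fun {x y} p => label lab ⟨x, y, p⟩ = some (Sum.inr ⟨j, c⟩) →
    ∃ (a : A j) (q : P j), lab j a q = some c ∧
      (⟨x, y, p⟩ : TotalPath (Star A P)) = ⟨_, _, two a q⟩) ?_ ?_ ?_ ?_ p
  · intro x h; exact absurd (Option.some_injective _ h) nofun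
  · intro j a h; exact absurd (Option.some_injective _ h) nofun
  · intro j p h; exact absurd (Option.some_injective _ h) nofun
  · intro j' a q h
    obtain ⟨c', hc', h'⟩ := Option.map_eq_some_iff.mp h
    cases h'
    exact ⟨a, q, hc', rfl⟩

variable {k : Type*} [Field k] [Finite J] {lab : ∀ j, A j → P j → Option (C j)}

theorem respectsRelations {f : ∀ j, A j → G} {g : ∀ j, P j → G} (h : Compatible lab f g) :
    RespectsRelations (labelIdeal k lab) (arrowVal f g) := by
  intro x y ρ hρ p hp q hq
  obtain ⟨ξ, hξ⟩ := hρ.exists_label fun f => mem_labelIdeal (lab := lab)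
  have hw : ∀ t t' : TotalPath (Star A P), t = t' →
      walkWeight (arrowVal f g) (toWalk t.path) = walkWeight (arrowVal f g) (toWalk t'.path) := by
    rintro t _ rfl; rfl
  rcases ξ with t | ⟨j, c⟩
  · exact hw ⟨x, y, p⟩ ⟨x, y, q⟩ ((eq_of_label_eq_inl p (hξ p hp)).trans
      (eq_of_label_eq_inl q (hξ q hq)).symm)
  · obtain ⟨a, p', hc, h1⟩ := eq_of_label_eq_inr p (hξ p hp)
    obtain ⟨a', q', hc', h2⟩ := eq_of_label_eq_inr q (hξ q hq)
    refine (hw _ _ h1).trans (Eq.trans ?_ (hw _ _ h2).symm)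
    rw [walkWeight_two, walkWeight_two]
    exact h j a a' p' q' c hc hc'

/-- The base walks form a spanning tree. The loop classes of the arrows along it satisfy the
defining relations of `G`, so `exists_hom` provides the inverse of the weight homomorphism. -/
theorem nonempty_mulEquiv_of_isLabelGroup {a₀ : ∀ j, A j} {p₀ : ∀ j, P j} {f : ∀ j, A j → G}
    {g : ∀ j, P j → G} (h : IsLabelGroup lab a₀ p₀ f g) (v : Star A P) :
    Nonempty (FundamentalGroup (labelIdeal k lab) v ≃* G) := by
  set I := labelIdeal k lab
  let t : ∀ x : Quiver.Symmetrify (Star A P),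
    Walk (Quiver.Symmetrify.of.obj (center : Star A P)) x := baseWalk a₀ p₀
  obtain ⟨e⟩ := nonempty_mulEquiv_fundamentalGroup_of_walk (I := I) (v₀ := center)
    (baseWalk a₀ p₀ v).reverse
  have hbase : ∀ j, loopClass I t (arrowWalk (fst (a₀ j))) = 1 := fun j => by
    refine Quotient.sound (show Homotopic I _ _ from ?_)
    exact Homotopic.comp_reverse I (arrowWalk (fst (a₀ j)))
  have hbase' : ∀ j, loopClass I t (arrowWalk (snd (p₀ j))) = 1 := fun j => by
    refine Quotient.sound (show Homotopic I _ _ from ?_)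
    exact Homotopic.comp_reverse I ((arrowWalk (fst (a₀ j))).comp (arrowWalk (snd (p₀ j))))
  have htwo : ∀ {j : J} (a : A j) (p : P j), loopClass I t (toWalk (two a p)) =
      loopClass I t (arrowWalk (fst a)) * loopClass I t (arrowWalk (snd p)) :=
    fun a p => loopClass_comp (I := I) (t := t) (arrowWalk (fst a)) (arrowWalk (snd p))
  obtain ⟨Ψ, h1, h2⟩ := h.exists_hom (fun j a => loopClass I t (arrowWalk (fst a)))
    (fun j p => loopClass I t (arrowWalk (snd p))) hbase hbase' (by
      intro j a a' p p' c hc hc'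
      rw [← htwo, ← htwo]
      refine loopClass_congr (homotopic_of_label_eq (lab := label lab)
        (ξ := Sum.inr ⟨j, c⟩) (fun f => mem_labelIdeal) ?_ ?_)
      · exact congrArg (Option.map _) hc
      · exact congrArg (Option.map _) hc')
  obtain ⟨e'⟩ := nonempty_mulEquiv_fundamentalGroup (I := I) (t := t) (val := arrowVal f g)
    (respectsRelations h.compatible) rfl
    (by
      rintro (_ | j | j)
      · rfl
      · exact (one_mul _).trans (h.base_fst j)
      · refine (walkWeight_comp (arrowVal f g) (arrowWalk (fst (a₀ j)))
          (arrowWalk (snd (p₀ j)))).trans ?_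
        rw [walkWeight_arrowWalk, walkWeight_arrowWalk]
        exact (congrArg₂ _ (h.base_fst j) (h.base_snd j)).trans (one_mul 1))
    Ψ
    (by
      rintro _ _ (a | p)
      · exact h1 _ a
      · exact h2 _ p)
    (fun θ hθ => h.hom_ext θ (fun j a => hθ _ _ (fst a)) fun j p => hθ _ _ (snd p))
  exact ⟨e.trans e'⟩

end FundamentalGroup

end Star

end BoundQuiver

namespace BoundQuiver
namespace Star

variable {J : Type} {A P : J → Type}

/-! ### Transvections and twin presentations -/

section Twist

variable {k : Type*} [Field k] {C : J → Type} {lab lab' : ∀ j, A j → P j → Option (C j)}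

/-- The labels `lab'` are obtained from the labels `lab` by the transvection which adds the arrow
`b` to the arrows in `sh`. -/
structure IsTwist (b : ∀ j, A j) (sh : ∀ j, A j → Prop)
    (lab lab' : ∀ j, A j → P j → Option (C j)) : Prop where
  not_shift_base : ∀ j, ¬ sh j (b j)
  eq_of_not_shift : ∀ j a p, ¬ sh j a → lab' j a p = lab j a p
  of_shift : ∀ j a p, sh j a → (lab j (b j) p = none ∧ lab' j a p = lab j a p) ∨
    (lab j a p = none ∧ lab' j a p = lab j (b j) p)

variable (b : ∀ j, A j) (sh : ∀ j, A j → Prop)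

open Classical in
/-- The substitution `a ↦ a + c b` for the arrows `a` in `sh`. -/
noncomputable def twistArrow (c : k) :
    ∀ x y : Star A P, (x ⟶ y) → PathAlgebra k (Star A P)
  | _, _, @StarHom.fst _ _ _ j a => PathAlgebra.ofPath (fst a).toPath +
      if sh j a then c • PathAlgebra.ofPath (fst (b j)).toPath else 0
  | _, _, StarHom.snd p => PathAlgebra.ofPath (snd p).toPath

theorem twistArrow_mul [Finite J] (c : k) (x y : Star A P) (α : x ⟶ y) :
    twistArrow b sh c x y α * PathAlgebra.ofPath (Quiver.Path.nil : Quiver.Path y y) =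
      twistArrow b sh c x y α := by
  rcases α with a | p
  · rw [twistArrow, add_mul, PathAlgebra.ofPath_mul_nil]
    split_ifs
    · rw [smul_mul_assoc, PathAlgebra.ofPath_mul_nil]
    · rw [zero_mul]
  · exact PathAlgebra.ofPath_mul_nil _

/-- The transvection `a ↦ a + c b` for the arrows `a` in `sh`. -/
noncomputable def twist [Finite J] (c : k) :
    PathAlgebra k (Star A P) →ₐ[k] PathAlgebra k (Star A P) :=
  PathAlgebra.substHom (e := fun x => PathAlgebra.ofPath (Quiver.Path.nil : Quiver.Path x x))
    (E := twistArrow b sh c) (fun _ => PathAlgebra.ofPath_mul_ofPath_comp _ _)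
    (fun _ _ h => PathAlgebra.ofPath_mul_ofPath_ne _ _ (Ne.symm h)) rfl (twistArrow_mul b sh c)

variable [Finite J]

theorem twist_nil (c : k) (x : Star A P) :
    twist b sh c (PathAlgebra.ofPath (Quiver.Path.nil : Quiver.Path x x)) =
      PathAlgebra.ofPath (Quiver.Path.nil : Quiver.Path x x) :=
  PathAlgebra.substHom_ofPath _ _ _ _ _

open Classical in
theorem twist_fst (c : k) {j : J} (a : A j) :
    twist (P := P) b sh c (PathAlgebra.ofPath (fst a).toPath) =
      PathAlgebra.ofPath (fst a).toPath +
        if sh j a then c • PathAlgebra.ofPath (fst (b j)).toPath else 0 := by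
  refine (PathAlgebra.substHom_ofPath _ _ _ _ _).trans ?_
  change PathAlgebra.ofPath Quiver.Path.nil * (PathAlgebra.ofPath (fst a).toPath +
    if sh j a then c • PathAlgebra.ofPath (fst (b j)).toPath else 0) = _
  rw [mul_add, PathAlgebra.nil_mul_ofPath]
  split_ifs
  · rw [mul_smul_comm, PathAlgebra.nil_mul_ofPath]
  · rw [mul_zero]

theorem twist_snd (c : k) {j : J} (p : P j) :
    twist (A := A) b sh c (PathAlgebra.ofPath (snd p).toPath) =
      PathAlgebra.ofPath (snd p).toPath := by
  refine (PathAlgebra.substHom_ofPath _ _ _ _ _).trans ?_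
  exact PathAlgebra.nil_mul_ofPath _

open Classical in
theorem twist_two (c : k) {j : J} (a : A j) (p : P j) :
    twist b sh c (PathAlgebra.ofPath (two a p)) = PathAlgebra.ofPath (two a p) +
      if sh j a then c • PathAlgebra.ofPath (two (b j) p) else 0 := by
  rw [two, ← PathAlgebra.ofPath_mul_ofPath_comp, map_mul, twist_fst, twist_snd, add_mul]
  split_ifs
  · rw [smul_mul_assoc, PathAlgebra.ofPath_mul_ofPath_comp, PathAlgebra.ofPath_mul_ofPath_comp]
    rfl
  · rw [zero_mul]

/-- The arrow `b` is itself fixed, so the two multiples of `b` added to a shifted arrow cancel. -/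
theorem twist_twist_neg (hb : ∀ j, ¬ sh j (b j)) (c : k) (f : PathAlgebra k (Star A P)) :
    twist b sh c (twist b sh (-c) f) = f := by
  have h : (twist b sh c).toLinearMap.comp (twist b sh (-c)).toLinearMap =
      (LinearMap.id : PathAlgebra k (Star A P) →ₗ[k] _) := by
    refine PathAlgebra.lhom_ext fun x y p => path_cases (motive := fun p =>
      twist b sh c (twist b sh (-c) (PathAlgebra.ofPath p)) = PathAlgebra.ofPath p)
      (fun x => ?_) (fun {j} a => ?_) (fun p => ?_) (fun {j} a p => ?_) p
    · rw [twist_nil, twist_nil]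
    · rw [twist_fst, map_add, twist_fst]
      split_ifs
      · rw [map_smul, twist_fst, if_neg (hb j), add_zero, neg_smul, add_neg_cancel_right]
      · rw [map_zero, add_zero, add_zero]
    · rw [twist_snd, twist_snd]
    · rw [twist_two, map_add, twist_two]
      split_ifs
      · rw [map_smul, twist_two, if_neg (hb j), add_zero, neg_smul, add_neg_cancel_right]
      · rw [map_zero, add_zero, add_zero]
  exact congrArg (fun T => T f) h

variable {b sh}

/-- For a shifted `a`, at least one of the paths `a`, `p` and `b`, `p` is unlabelled, so the image
of their sum is still zero or a single basis vector, as a labelling requires. -/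
theorem IsTwist.labelMap_twist_two (h : IsTwist b sh lab lab') {j : J} (a : A j) (p : P j) :
    labelMap k (label lab) (twist b sh 1 (PathAlgebra.ofPath (two a p))) =
      labelMap k (label lab') (PathAlgebra.ofPath (two a p)) := by
  rw [twist_two, map_add, labelMap_two, labelMap_two]
  split_ifs with hs
  · rw [one_smul, labelMap_two]
    rcases h.of_shift j a p hs with ⟨h1, h2⟩ | ⟨h1, h2⟩
    · rw [h1, h2]; exact add_zero _
    · rw [h1, h2]; exact zero_add _
  · rw [h.eq_of_not_shift j a p hs, map_zero, add_zero]

theorem IsTwist.labelMap_twist_neg_two (h : IsTwist b sh lab lab') {j : J} (a : A j) (p : P j) :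
    labelMap k (label lab') (twist b sh (-1) (PathAlgebra.ofPath (two a p))) =
      labelMap k (label lab) (PathAlgebra.ofPath (two a p)) := by
  rw [twist_two, map_add, ← h.labelMap_twist_two a p, twist_two, map_add, add_assoc]
  refine add_eq_left.mpr ?_
  split_ifs with hs
  · rw [map_smul, map_smul, ← h.labelMap_twist_two (b j) p, twist_two,
      if_neg (h.not_shift_base j), add_zero, one_smul, neg_smul, one_smul, add_neg_cancel]
  · rw [map_zero, map_zero, add_zero]

theorem IsTwist.mem_labelIdeal_iff (h : IsTwist b sh lab lab') (f : PathAlgebra k (Star A P)) :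
    twist b sh 1 f ∈ labelIdeal k lab ↔ f ∈ labelIdeal k lab' := by
  have key : ∀ {l l' : ∀ j, A j → P j → Option (C j)} (c : k),
      (∀ (j : J) (a : A j) (p : P j),
        labelMap k (label l) (twist b sh c (PathAlgebra.ofPath (two a p))) =
          labelMap k (label l') (PathAlgebra.ofPath (two a p))) →
      ∀ {f}, f ∈ labelIdeal k l' → twist b sh c f ∈ labelIdeal k l := by
    intro l l' c hl f hf
    exact map_eq_zero (lab := l') ((labelMap k (label l)).comp (twist b sh c).toLinearMap)
      (fun j c => Finsupp.single (Sum.inr ⟨j, c⟩) 1)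
      (fun j a p => (hl j a p).trans (labelMap_two a p)) hf
  refine ⟨fun hf => ?_, key 1 fun j a p => h.labelMap_twist_two a p⟩
  have h1 := key (-1) (fun j a p => h.labelMap_twist_neg_two a p) hf
  have h2 := twist_twist_neg b sh h.not_shift_base (-1 : k) f
  rw [neg_neg] at h2
  rwa [h2] at h1

variable [∀ j, Finite (A j)] [∀ j, Finite (P j)] (a₀ : ∀ j, A j) (p₀ : ∀ j, P j)

theorem IsTwist.isTwinPresentation (h : IsTwist b sh lab lab') {G : Type*} [Group G]
    {f : ∀ j, A j → G} {g : ∀ j, P j → G} (hG : IsLabelGroup lab a₀ p₀ f g)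
    (h1 : IsLabelGroup lab' a₀ p₀ (fun _ _ => (1 : Unit)) fun _ _ => (1 : Unit)) :
    IsTwinPresentation k (toFinConnQuiver a₀ p₀) (labelIdeal k lab) (labelIdeal k lab')
      (PathAlgebra k (Star A P) ⧸ labelIdeal k lab) G where
  triangular := ⟨toFinConnQuiver a₀ p₀, labelIdeal k lab, isAcyclic, isAdmissible_labelIdeal,
    Ideal.Quotient.mkₐ k (labelIdeal k lab), Ideal.Quotient.mkₐ_surjective k _,
    Ideal.Quotient.mkₐ_ker k _⟩
  acyclic := isAcyclic
  presentation := ⟨isAdmissible_labelIdeal, Ideal.Quotient.mkₐ k (labelIdeal k lab),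
    Ideal.Quotient.mkₐ_surjective k _, Ideal.Quotient.mkₐ_ker k _⟩
  presentation' := by
    -- Precomposing the quotient map with the automorphism changes the kernel but not the algebra.
    refine ⟨isAdmissible_labelIdeal, (Ideal.Quotient.mkₐ k (labelIdeal k lab)).comp
      (twist b sh 1), ?_, ?_⟩
    · exact (Ideal.Quotient.mkₐ_surjective k _).comp fun f =>
        ⟨_, twist_twist_neg b sh h.not_shift_base 1 f⟩
    · ext f
      exact Ideal.Quotient.eq_zero_iff_mem.trans (h.mem_labelIdeal_iff f)
  fundamentalGroup := nonempty_mulEquiv_of_isLabelGroup hG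
  fundamentalGroup' v := by
    obtain ⟨e⟩ := nonempty_mulEquiv_of_isLabelGroup (k := k) h1 v
    exact e.injective.subsingleton

end Twist

/-! ### Stars as coproducts -/

section Ray

/-- The inclusion of a ray of a star. -/
def rayMap (A P : J → Type) (j : J) :
    Star (fun _ : Unit => A j) (fun _ : Unit => P j) ⥤q Star A P where
  obj
    | center => center
    | mid _ => mid j
    | fin _ => fin j
  map
    | StarHom.fst a => fst a
    | StarHom.snd p => snd p

theorem isWedge_rayMap (A P : Bool → Type) :
    IsWedge (rayMap A P false) (rayMap A P true) center center where
  injective_left := by rintro (_ | _ | _) (_ | _ | _) h <;> first | rfl | cases h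
  injective_right := by rintro (_ | _ | _) (_ | _ | _) h <;> first | rfl | cases h
  obj_eq_iff := by
    rintro (_ | _ | _) (_ | _ | _) <;>
      first
        | exact ⟨fun _ => ⟨rfl, rfl⟩, fun _ => rfl⟩
        | exact ⟨nofun, nofun⟩
  obj_surjective := by
    rintro (_ | (_ | _) | (_ | _))
    · exact Or.inl ⟨center, rfl⟩
    · exact Or.inl ⟨mid (), rfl⟩
    · exact Or.inr ⟨mid (), rfl⟩
    · exact Or.inl ⟨fin (), rfl⟩
    · exact Or.inr ⟨fin (), rfl⟩
  arrow_bijective := by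
    constructor
    · rintro (⟨_, _, (a | a)⟩ | ⟨_, _, (a | a)⟩) (⟨_, _, (b | b)⟩ | ⟨_, _, (b | b)⟩) h <;>
        cases h <;> rfl
    · rintro ⟨_, _, (@⟨(_ | _), a⟩ | @⟨(_ | _), a⟩)⟩
      · exact ⟨Sum.inl ⟨_, _, StarHom.fst (j := ()) a⟩, rfl⟩
      · exact ⟨Sum.inr ⟨_, _, StarHom.fst (j := ()) a⟩, rfl⟩
      · exact ⟨Sum.inl ⟨_, _, StarHom.snd (j := ()) a⟩, rfl⟩
      · exact ⟨Sum.inr ⟨_, _, StarHom.snd (j := ()) a⟩, rfl⟩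

variable {k : Type*} [Field k] {C : J → Type} {lab : ∀ j, A j → P j → Option (C j)}

theorem map_rayMap_two (j : J) (a : A j) (p : P j) :
    PathAlgebra.map k (rayMap A P j)
      (PathAlgebra.ofPath (two (A := fun _ => A j) (P := fun _ => P j) (j := ()) a p)) =
      PathAlgebra.ofPath (two a p) :=
  PathAlgebra.map_ofPath _ _

variable [Finite J]

/-- The ideal `labelIdeal` is spanned by the unlabelled paths of length two and the differences of
paths of length two with the same label. -/
theorem mem_of_mem_labelIdeal (S : Submodule k (PathAlgebra k (Star A P)))
    (h0 : ∀ (j : J) (a : A j) (p : P j), lab j a p = none → PathAlgebra.ofPath (two a p) ∈ S)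
    (h1 : ∀ (j : J) (a a' : A j) (p p' : P j) (c : C j), lab j a p = some c →
      lab j a' p' = some c → PathAlgebra.ofPath (two a p) - PathAlgebra.ofPath (two a' p') ∈ S)
    {f : PathAlgebra k (Star A P)} (hf : f ∈ labelIdeal k lab) : f ∈ S := by
  classical
  rw [← Submodule.Quotient.mk_eq_zero]
  -- Modulo `S` a path of length two depends only on its label, so any chosen path represents the
  -- label; labels that do not occur get the dummy value 0.
  refine map_eq_zero (lab := lab) S.mkQ (fun j c => if h : ∃ t : A j × P j, lab j t.1 t.2 = some c
    then S.mkQ (PathAlgebra.ofPath (two h.choose.1 h.choose.2)) else 0) (fun j a p => ?_) hf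
  cases hc : lab j a p with
  | none => exact (Submodule.Quotient.mk_eq_zero S).mpr (h0 j a p hc)
  | some c =>
    have h : ∃ t : A j × P j, lab j t.1 t.2 = some c := ⟨(a, p), hc⟩
    refine Eq.trans ?_ (dif_pos h).symm
    exact (Submodule.Quotient.eq S).mpr (h1 j _ _ _ _ c hc h.choose_spec)

theorem map_rayMap_mem_labelIdeal (j : J)
    {f : PathAlgebra k (Star (fun _ : Unit => A j) (fun _ : Unit => P j))}
    (hf : f ∈ labelIdeal k fun _ : Unit => lab j) :
    PathAlgebra.map k (rayMap A P j) f ∈ labelIdeal k lab := by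
  refine map_eq_zero (lab := fun _ : Unit => lab j) ((labelMap k (label lab)).comp
    (PathAlgebra.map k (rayMap A P j))) (fun _ c => Finsupp.single (Sum.inr ⟨j, c⟩) 1)
    (fun _ a p => ?_) hf
  rw [LinearMap.comp_apply, map_rayMap_two, labelMap_two]

/-- Labels are tagged with their ray, so every spanning element of the ideal lives in a single ray
and belongs to the ideal of that ray. -/
theorem labelIdeal_eq_coproductIdeal {A P : Bool → Type} {C : Bool → Type}
    (lab : ∀ j, A j → P j → Option (C j)) :
    labelIdeal k lab = coproductIdeal (rayMap A P false) (rayMap A P true)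
      (labelIdeal k fun _ : Unit => lab false) (labelIdeal k fun _ : Unit => lab true) := by
  refine le_antisymm (fun f hf => ?_) ?_
  · have hmem : ∀ (j : Bool) (f : PathAlgebra k (Star (fun _ : Unit => A j) fun _ => P j)),
        f ∈ labelIdeal k (fun _ : Unit => lab j) →
        PathAlgebra.map k (rayMap A P j) f ∈
          coproductIdeal (rayMap A P false) (rayMap A P true)
            (labelIdeal k fun _ : Unit => lab false) (labelIdeal k fun _ : Unit => lab true) := by
      rintro (_ | _) f hf
      · exact TwoSidedIdeal.subset_span (Or.inl ⟨f, hf, rfl⟩)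
      · exact TwoSidedIdeal.subset_span (Or.inr ⟨f, hf, rfl⟩)
    refine mem_of_mem_labelIdeal (lab := lab) (Submodule.restrictScalars k
      (coproductIdeal (rayMap A P false) (rayMap A P true)
        (labelIdeal k fun _ : Unit => lab false) (labelIdeal k fun _ : Unit => lab true)))
      (fun j a p h => ?_) (fun j a a' p p' c h h' => ?_) hf
    · have h2 := hmem j (PathAlgebra.ofPath (two (A := fun _ => A j) (P := fun _ => P j)
        (j := ()) a p)) (by rw [mem_labelIdeal, labelMap_two, h]; rfl)
      rwa [map_rayMap_two] at h2
    · have h2 := hmem j (PathAlgebra.ofPath (two (A := fun _ => A j) (P := fun _ => P j)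
        (j := ()) a p) - PathAlgebra.ofPath (two (A := fun _ => A j) (P := fun _ => P j)
        (j := ()) a' p')) (by
          rw [mem_labelIdeal, map_sub, labelMap_two, labelMap_two, h, h', sub_self])
      rwa [map_sub, map_rayMap_two, map_rayMap_two] at h2
  · have h : TwoSidedIdeal.span (PathAlgebra.map k (rayMap A P false) ''
        (labelIdeal k fun _ : Unit => lab false) ∪ PathAlgebra.map k (rayMap A P true) ''
        (labelIdeal k fun _ : Unit => lab true)) ≤ (labelIdeal k lab).toTwoSided := by
      rw [TwoSidedIdeal.span_le]
      rintro _ (⟨f, hf, rfl⟩ | ⟨f, hf, rfl⟩)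
      · exact Ideal.mem_toTwoSided.mpr (map_rayMap_mem_labelIdeal false hf)
      · exact Ideal.mem_toTwoSided.mpr (map_rayMap_mem_labelIdeal true hf)
    exact fun f hf => Ideal.mem_toTwoSided.mp (h hf)

end Ray

end Star

/-! ### Stars of a presented group -/

/-- The arrows of the first layer of the star of a presentation with `n` generators. -/
inductive GenArrow (n : ℕ) : Type
  | shift : GenArrow n
  | one : GenArrow n
  | gen (i : Fin n) : GenArrow n

instance (n : ℕ) : Finite (GenArrow n) :=
  Finite.of_injective
    (fun a : GenArrow n => match a with
      | GenArrow.shift => (none : Option (Option (Fin n)))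
      | GenArrow.one => some none
      | GenArrow.gen i => some (some i))
    (by rintro (_ | _ | i) (_ | _ | j) h <;> simp_all)

section Presentation

variable {n : ℕ} (R : Set (FreeGroup (Fin n)))

/-- The identity and the suffixes of the relators. -/
def relatorSuffixes : Set (FreeGroup (Fin n)) :=
  insert 1 (⋃ r ∈ R, FreeGroup.mk '' {l | l <:+ r.toWord})

theorem finite_relatorSuffixes {R : Set (FreeGroup (Fin n))} (hR : R.Finite) :
    (relatorSuffixes R).Finite := by
  refine (hR.biUnion fun r _ => Set.Finite.image _ ?_).insert 1
  exact (List.finite_toSet r.toWord.tails).subset fun l hl => (List.mem_tails _ _).mpr hl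

/-- The labels of the paths of length two in the star of a presentation. The second argument is an
arrow of the second layer: there is one such arrow for each suffix of a relator and a further one,
`none`. The labels of the paths ending with the latter depend on `τ`. -/
def presLabel (τ : Bool) :
    GenArrow n → Option (relatorSuffixes R) → Option (PresentedGroup R)
  | GenArrow.shift, none => some 1
  | GenArrow.one, none => some 1
  | GenArrow.gen _, none => if τ then some 1 else none
  | GenArrow.shift, some _ => none
  | GenArrow.one, some s => some (PresentedGroup.mk R s)
  | GenArrow.gen i, some s => some (PresentedGroup.of i * PresentedGroup.mk R s)

/-- The weights of the arrows of the first layer. -/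
def genWeight : GenArrow n → PresentedGroup R
  | GenArrow.gen i => PresentedGroup.of i
  | _ => 1

/-- The weights of the arrows of the second layer. -/
def suffixWeight : Option (relatorSuffixes R) → PresentedGroup R
  | some s => PresentedGroup.mk R s
  | none => 1

variable {R}

/-- This needs the paths `gen i`, `none` to be unlabelled: their weight is the generator, whereas `τ
= true` would label them 1. -/
theorem genWeight_mul_suffixWeight {a : GenArrow n} {s : Option (relatorSuffixes R)}
    {c : PresentedGroup R} (h : presLabel R false a s = some c) :
    genWeight R a * suffixWeight R s = c := by
  rcases a with _ | _ | i <;> rcases s with _ | s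
  · exact (one_mul _).trans (Option.some_injective _ h)
  · cases h
  · exact (one_mul _).trans (Option.some_injective _ h)
  · exact (one_mul _).trans (Option.some_injective _ h)
  · cases h
  · exact Option.some_injective _ h

/-! ### Compatible weights and homomorphisms from the presented group -/

section Hom

variable {τ : Bool} {K : Type*} [Group K] {f : GenArrow n → K}
  {g : Option (relatorSuffixes R) → K}

/-- Induction on the suffix. For a letter `x_i`, the path `one`, `x_i s` shares its label with `gen
i`, `s`. For a letter `x_i⁻¹`, the path `gen i`, `x_i⁻¹ s` shares its label with `one`, `s`. -/
theorem eq_lift_of_compatible (hf : f GenArrow.one = 1) (hg : g none = 1)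
    (h : ∀ (a a' : GenArrow n) (s s' : Option (relatorSuffixes R)) (c : PresentedGroup R),
      presLabel R τ a s = some c → presLabel R τ a' s' = some c → f a * g s = f a' * g s')
    (s : relatorSuffixes R) :
    g (some s) = FreeGroup.lift (fun i => f (GenArrow.gen i)) (s : FreeGroup (Fin n)) := by
  have hone : ∀ hs, g (some ⟨1, hs⟩) = 1 := fun hs => by
    have h1 := h GenArrow.one GenArrow.one (some ⟨1, hs⟩) none 1
      (congrArg some (map_one (PresentedGroup.mk R))) rfl
    rwa [hf, hg, one_mul, one_mul] at h1
  obtain ⟨s, hs⟩ := s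
  change g (some ⟨s, hs⟩) = FreeGroup.lift (fun i => f (GenArrow.gen i)) s
  rcases (show s = 1 ∨ s ∈ ⋃ r ∈ R, FreeGroup.mk '' {l | l <:+ r.toWord} from hs) with h1 | hsR
  · subst h1
    rw [hone, map_one]
  · obtain ⟨r, hr, l, hl, rfl⟩ : ∃ r ∈ R, ∃ l, l <:+ r.toWord ∧ FreeGroup.mk l = s := by
      simpa using hsR
    clear hsR
    induction l with
    | nil => exact (hone hs).trans (map_one _).symm
    | cons x l ih =>
      have hl' : l <:+ r.toWord := (List.suffix_cons x l).trans hl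
      have hs' : FreeGroup.mk l ∈ relatorSuffixes R :=
        Or.inr (Set.mem_biUnion hr ⟨l, hl', rfl⟩)
      have ih' := ih hl' hs'
      obtain ⟨i, b⟩ := x
      cases b with
      | true =>
        have hmk : (FreeGroup.mk ((i, true) :: l) : FreeGroup (Fin n)) =
            FreeGroup.of i * FreeGroup.mk l := rfl
        have h1 := h GenArrow.one (GenArrow.gen i) (some ⟨_, hs⟩) (some ⟨_, hs'⟩) _ rfl
          (congrArg some ((map_mul (PresentedGroup.mk R) (FreeGroup.of i)
            (FreeGroup.mk l)).symm))
        rw [hf, one_mul, ih'] at h1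
        rw [h1, hmk, map_mul, FreeGroup.lift_apply_of]
      | false =>
        have hmk : (FreeGroup.mk ((i, false) :: l) : FreeGroup (Fin n)) =
            (FreeGroup.of i)⁻¹ * FreeGroup.mk l := rfl
        have hlab : PresentedGroup.of i * PresentedGroup.mk R (FreeGroup.mk ((i, false) :: l)) =
            PresentedGroup.mk R (FreeGroup.mk l) :=
          (map_mul (PresentedGroup.mk R) (FreeGroup.of i) _).symm.trans
            (congrArg _ (by rw [hmk, mul_inv_cancel_left]))
        have hlift : FreeGroup.lift (fun i => f (GenArrow.gen i))
            (FreeGroup.mk ((i, false) :: l)) = (f (GenArrow.gen i))⁻¹ *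
              FreeGroup.lift (fun i => f (GenArrow.gen i)) (FreeGroup.mk l) := by
          rw [hmk, map_mul, map_inv, FreeGroup.lift_apply_of]
        have h1 := h GenArrow.one (GenArrow.gen i) (some ⟨_, hs'⟩) (some ⟨_, hs⟩) _ rfl
          (congrArg some hlab)
        rw [hf, one_mul, ih'] at h1
        rw [hlift, h1, inv_mul_cancel_left]

theorem exists_hom_of_compatible (hf : f GenArrow.one = 1) (hg : g none = 1)
    (h : ∀ (a a' : GenArrow n) (s s' : Option (relatorSuffixes R)) (c : PresentedGroup R),
      presLabel R τ a s = some c → presLabel R τ a' s' = some c → f a * g s = f a' * g s') :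
    ∃ φ : PresentedGroup R →* K, (∀ a, φ (genWeight R a) = f a) ∧
      ∀ s, φ (suffixWeight R s) = g s := by
  have hlift := eq_lift_of_compatible hf hg h
  have hrel : ∀ r ∈ R, FreeGroup.lift (fun i => f (GenArrow.gen i)) r = 1 := fun r hr => by
    have hs : r ∈ relatorSuffixes R :=
      Or.inr (Set.mem_biUnion hr ⟨r.toWord, List.suffix_rfl, FreeGroup.mk_toWord⟩)
    rw [← hlift ⟨r, hs⟩]
    have h1 := h GenArrow.one GenArrow.one (some ⟨r, hs⟩) none 1
      (congrArg some (PresentedGroup.one_of_mem hr)) rfl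
    rwa [hf, hg, one_mul, one_mul] at h1
  refine ⟨PresentedGroup.toGroup hrel, ?_, ?_⟩
  · rintro (_ | _ | i)
    -- The weight of `shift` is forced to be 1 because `shift` and `one` have the same label before
    -- `none`.
    · have h1 := h GenArrow.shift GenArrow.one none none 1 rfl rfl
      rw [mul_left_inj, hf] at h1
      exact (map_one _).trans h1.symm
    · exact (map_one _).trans hf.symm
    · exact PresentedGroup.toGroup.of hrel
  · rintro (_ | s)
    · exact (map_one _).trans hg.symm
    · exact (hlift s).symm

/-- For `τ = true` every first-layer arrow has label 1 before `none`, hence the same weight as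
`one`. The suffix arrows are words in these trivial weights. -/
theorem eq_one_of_compatible (hf : f GenArrow.one = 1) (hg : g none = 1)
    (h : ∀ (a a' : GenArrow n) (s s' : Option (relatorSuffixes R)) (c : PresentedGroup R),
      presLabel R true a s = some c → presLabel R true a' s' = some c → f a * g s = f a' * g s') :
    (∀ a, f a = 1) ∧ ∀ s, g s = 1 := by
  have hfa : ∀ a, f a = 1 := by
    have key : ∀ a, presLabel R true a none = some 1 → f a = 1 := fun a ha => by
      have h1 := h a GenArrow.one none none 1 ha rfl
      rwa [mul_left_inj, hf] at h1
    rintro (_ | _ | i) <;> exact key _ rfl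
  refine ⟨hfa, ?_⟩
  rintro (_ | s)
  · exact hg
  · have hone : FreeGroup.lift (fun i => f (GenArrow.gen i)) = (1 : FreeGroup (Fin n) →* K) :=
      FreeGroup.ext_hom _ _ fun i => by rw [FreeGroup.lift_apply_of, hfa]; rfl
    rw [eq_lift_of_compatible hf hg h, hone]
    rfl

end Hom

end Presentation

/-! ### Twin presentations from a family of group presentations -/

section Family

variable {J : Type} {n : J → ℕ} (R : ∀ j, Set (FreeGroup (Fin (n j))))

/-- The vertices of the star whose rays are given by a family of presentations. -/
abbrev PresStar : Type :=
  Star (fun j => GenArrow (n j)) (fun j => Option (relatorSuffixes (R j)))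

/-- The quiver of a family of finite presentations. -/
noncomputable abbrev presQuiver [Finite J] (hR : ∀ j, (R j).Finite) : FinConnQuiver :=
  have : ∀ j, Finite (Option (relatorSuffixes (R j))) := fun j =>
    have := (finite_relatorSuffixes (hR j)).to_subtype
    inferInstance
  Star.toFinConnQuiver (A := fun j => GenArrow (n j))
    (P := fun j => Option (relatorSuffixes (R j))) (fun _ => GenArrow.one) (fun _ => none)

/-- The ideal of a family of presentations. -/
noncomputable abbrev presIdeal (k : Type*) [Field k] [Finite J] (τ : Bool) :
    Ideal (PathAlgebra k (PresStar R)) :=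
  Star.labelIdeal k fun j => presLabel (R j) τ

/-- Before `none`, the unlabelled `gen i` takes over the label of `shift`; before a suffix, `shift`
is unlabelled and nothing changes. -/
theorem isTwist_presLabel :
    Star.IsTwist (fun _ => GenArrow.shift) (fun _ a => ∃ i, a = GenArrow.gen i)
      (fun j => presLabel (R j) false) (fun j => presLabel (R j) true) where
  not_shift_base := by rintro j ⟨i, hi⟩; cases hi
  eq_of_not_shift := by
    rintro j (_ | _ | i) (_ | s) h <;> first | rfl | exact absurd ⟨i, rfl⟩ h
  of_shift := by
    rintro j _ (_ | s) ⟨i, rfl⟩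
    · exact Or.inr ⟨rfl, rfl⟩
    · exact Or.inl ⟨rfl, rfl⟩

theorem isLabelGroup_unit :
    Star.IsLabelGroup (fun j => presLabel (R j) true) (fun _ => GenArrow.one) (fun _ => none)
      (fun _ _ => (1 : Unit)) fun _ _ => (1 : Unit) where
  base_fst _ := rfl
  base_snd _ := rfl
  compatible _ _ _ _ _ _ _ _ := rfl
  exists_hom _ _ hf hg h :=
    ⟨1, fun j a => ((eq_one_of_compatible (hf j) (hg j) (h j)).1 a).symm,
      fun j s => ((eq_one_of_compatible (hf j) (hg j) (h j)).2 s).symm⟩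
  hom_ext _ _ _ := MonoidHom.ext fun _ => rfl

variable {R}

/-- A coproduct of presented groups is the group of the star of the family of presentations. -/
theorem isLabelGroup_of_coproduct {G : Type*} [Group G] (ι : ∀ j, PresentedGroup (R j) →* G)
    (hlift : ∀ {K : Type} [Group K] (φ : ∀ j, PresentedGroup (R j) →* K),
      ∃ ψ : G →* K, ∀ j, ψ.comp (ι j) = φ j)
    (hext : ∀ θ : G →* G, (∀ j, θ.comp (ι j) = ι j) → θ = MonoidHom.id G) :
    Star.IsLabelGroup (fun j => presLabel (R j) false) (fun _ => GenArrow.one) (fun _ => none)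
      (fun j a => ι j (genWeight (R j) a)) fun j s => ι j (suffixWeight (R j) s) where
  base_fst j := map_one (ι j)
  base_snd j := map_one (ι j)
  compatible j a a' s s' c hc hc' := by
    rw [← map_mul, ← map_mul, genWeight_mul_suffixWeight hc, genWeight_mul_suffixWeight hc']
  exists_hom f g hf hg h := by
    choose φ hφ using fun j => exists_hom_of_compatible (hf j) (hg j) (h j)
    obtain ⟨ψ, hψ⟩ := hlift φ
    exact ⟨ψ, fun j a => (DFunLike.congr_fun (hψ j) _).trans ((hφ j).1 a),
      fun j s => (DFunLike.congr_fun (hψ j) _).trans ((hφ j).2 s)⟩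
  hom_ext θ hθ _ := hext θ fun j => PresentedGroup.ext fun i => hθ j (GenArrow.gen i)

theorem isTwinPresentation_presIdeal (k : Type*) [Field k] [Finite J] (hR : ∀ j, (R j).Finite)
    {G : Type*} [Group G] (ι : ∀ j, PresentedGroup (R j) →* G)
    (hlift : ∀ {K : Type} [Group K] (φ : ∀ j, PresentedGroup (R j) →* K),
      ∃ ψ : G →* K, ∀ j, ψ.comp (ι j) = φ j)
    (hext : ∀ θ : G →* G, (∀ j, θ.comp (ι j) = ι j) → θ = MonoidHom.id G) :
    IsTwinPresentation k (presQuiver R hR) (presIdeal R k false) (presIdeal R k true)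
      (PathAlgebra k (PresStar R) ⧸ presIdeal R k false) G :=
  have : ∀ j, Finite (Option (relatorSuffixes (R j))) := fun j =>
    have := (finite_relatorSuffixes (hR j)).to_subtype
    inferInstance
  (isTwist_presLabel R).isTwinPresentation _ _ (isLabelGroup_of_coproduct ι hlift hext)
    (isLabelGroup_unit R)

end Family

theorem IsTwinPresentation.congr {k : Type*} [Field k] {Q : FinConnQuiver}
    {J J' : Ideal (PathAlgebra k Q.Vert)} {A : Type*} [Ring A] [Algebra k A] {G G' : Type*}
    [Group G] [Group G'] (h : IsTwinPresentation k Q J J' A G) (e : G ≃* G') :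
    IsTwinPresentation k Q J J' A G' :=
  { h with fundamentalGroup := fun v => (h.fundamentalGroup v).map fun f => f.trans e }

/-! ### Splitting off the free generators -/

/-- Reduction only deletes letters, so each letter of the reduced image comes from a letter of the
original word. -/
theorem mem_toWord_of_mem_toWord_map {α β : Type*} [DecidableEq α] [DecidableEq β] {κ : α → β}
    (hκ : Function.Injective κ) {x : FreeGroup α} {i : α} {b : Bool}
    (h : (κ i, b) ∈ (FreeGroup.map κ x).toWord) : (i, b) ∈ x.toWord := by
  rw [← FreeGroup.mk_toWord (x := x), FreeGroup.map.mk, FreeGroup.toWord_mk] at h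
  have h1 := (FreeGroup.Red.sublist FreeGroup.reduce.red).subset h
  obtain ⟨⟨i', b'⟩, h2, h3⟩ := List.mem_map.mp h1
  obtain ⟨h4, rfl⟩ := Prod.mk.inj h3
  rwa [← hκ h4]

theorem exists_map_eq_of_forall_mem_toWord {α β : Type*} [DecidableEq β] {κ : α → β}
    {x : FreeGroup β} (h : ∀ i b, (i, b) ∈ x.toWord → i ∈ Set.range κ) :
    ∃ y, FreeGroup.map κ y = x := by
  have key : ∀ l : List (β × Bool), (∀ i b, (i, b) ∈ l → i ∈ Set.range κ) →
      ∃ y, FreeGroup.map κ y = FreeGroup.mk l := by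
    intro l
    induction l with
    | nil => exact fun _ => ⟨1, rfl⟩
    | cons a l ih =>
      intro hl
      obtain ⟨y, hy⟩ := ih fun i b hi => hl i b (List.mem_cons_of_mem _ hi)
      obtain ⟨i, b⟩ := a
      obtain ⟨i', rfl⟩ := hl i b List.mem_cons_self
      refine ⟨FreeGroup.mk [(i', b)] * y, ?_⟩
      rw [map_mul, hy, FreeGroup.map.mk, FreeGroup.mul_mk]
      rfl
  obtain ⟨y, hy⟩ := key x.toWord h
  exact ⟨y, hy.trans FreeGroup.mk_toWord⟩

/-- If all relators are words in a subset of the generators, then the group is the coproduct of the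
free group on the remaining generators and the group presented by the subset. -/
theorem nonempty_mulEquiv_coprod {α β γ : Type*} (ε : α ⊕ β ≃ γ) (R : Set (FreeGroup γ))
    (hR : ∀ r ∈ R, ∃ y, FreeGroup.map (fun i => ε (Sum.inr i)) y = r) :
    Nonempty (PresentedGroup R ≃* Monoid.Coprod (FreeGroup α)
      (PresentedGroup (FreeGroup.map (fun i => ε (Sum.inr i)) ⁻¹' R))) := by
  set κ : β → γ := fun i => ε (Sum.inr i)
  set R' : Set (FreeGroup β) := FreeGroup.map κ ⁻¹' R
  let f : γ → Monoid.Coprod (FreeGroup α) (PresentedGroup R') := fun i =>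
    Sum.elim (fun j => Monoid.Coprod.inl (FreeGroup.of j))
      (fun j => Monoid.Coprod.inr (PresentedGroup.of j)) (ε.symm i)
  have hfκ : (FreeGroup.lift f).comp (FreeGroup.map κ) =
      Monoid.Coprod.inr.comp (PresentedGroup.mk R') :=
    FreeGroup.ext_hom _ _ fun j => by
      rw [MonoidHom.comp_apply, FreeGroup.map.of, FreeGroup.lift_apply_of]
      simp only [f, κ, Equiv.symm_apply_apply, Sum.elim_inr]
      rfl
  have hf : ∀ r ∈ R, FreeGroup.lift f r = 1 := by
    intro r hr
    obtain ⟨y, rfl⟩ := hR r hr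
    have hy : PresentedGroup.mk R' y = 1 := PresentedGroup.one_of_mem hr
    refine (DFunLike.congr_fun hfκ y).trans ?_
    rw [MonoidHom.comp_apply, hy, map_one]
  have hgκ : FreeGroup.lift (fun j => (PresentedGroup.of (κ j) : PresentedGroup R)) =
      (PresentedGroup.mk R).comp (FreeGroup.map κ) :=
    FreeGroup.ext_hom _ _ fun j => by
      rw [FreeGroup.lift_apply_of, MonoidHom.comp_apply, FreeGroup.map.of]
      rfl
  have hg : ∀ r ∈ R',
      FreeGroup.lift (fun j => (PresentedGroup.of (κ j) : PresentedGroup R)) r = 1 :=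
    fun r hr => by
      rw [hgκ]
      exact PresentedGroup.one_of_mem (show FreeGroup.map κ r ∈ R from hr)
  refine ⟨MonoidHom.toMulEquiv (PresentedGroup.toGroup hf) (Monoid.Coprod.lift
    (FreeGroup.lift fun j => PresentedGroup.of (ε (Sum.inl j))) (PresentedGroup.toGroup hg)) ?_ ?_⟩
  · refine PresentedGroup.ext fun i => ?_
    rw [MonoidHom.comp_apply, PresentedGroup.toGroup.of]
    obtain ⟨j | j, rfl⟩ := ε.surjective i
    · simp [f]
    · simp [f, κ]
  · refine Monoid.Coprod.hom_ext (FreeGroup.ext_hom _ _ fun j => ?_)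
      (PresentedGroup.ext fun j => ?_)
    · simp [f]
    · simp [f, κ]

theorem exists_coprod_presentationWithoutFreeGenerators (G : Type*) [Group G]
    [Group.IsFinitelyPresented G] :
    ∃ (m : ℕ) (H : Type) (_ : Group H), HasPresentationWithoutFreeGenerators H ∧
      Nonempty (G ≃* Monoid.Coprod (FreeGroup (Fin m)) H) := by
  classical
  obtain ⟨n, R, hR, ⟨e⟩⟩ := Group.IsFinitelyPresented.exists_mulEquiv_presentedGroup (G := G)
  let used : Fin n → Prop := fun i => ∃ r ∈ R, ∃ b : Bool, (i, b) ∈ r.toWord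
  -- The unused generators span the free factor; all relators are words in the used ones, which
  -- present `H`.
  let ε : Fin (Fintype.card {i // ¬ used i}) ⊕ Fin (Fintype.card {i // used i}) ≃ Fin n :=
    (Equiv.sumComm _ _).trans (((Fintype.equivFin _).symm.sumCongr
      (Fintype.equivFin _).symm).trans (Equiv.sumCompl used))
  have hinj : Function.Injective fun i => ε (Sum.inr i) :=
    ε.injective.comp Sum.inr_injective
  have hused : ∀ i, used (ε (Sum.inr i)) := fun i => ((Fintype.equivFin _).symm i).2
  have hrange : ∀ i, used i → i ∈ Set.range fun i => ε (Sum.inr i) := fun i hi =>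
    ⟨Fintype.equivFin _ ⟨i, hi⟩, by simp [ε]⟩
  have hmap : ∀ r ∈ R, ∃ y, FreeGroup.map (fun i => ε (Sum.inr i)) y = r := fun r hr =>
    exists_map_eq_of_forall_mem_toWord fun i b hi => hrange i ⟨r, hr, b, hi⟩
  obtain ⟨e'⟩ := nonempty_mulEquiv_coprod ε R hmap
  refine ⟨_, _, inferInstance, ⟨_, FreeGroup.map (fun i => ε (Sum.inr i)) ⁻¹' R,
    hR.preimage (FreeGroup.map_injective hinj).injOn, fun i => ?_, ⟨MulEquiv.refl _⟩⟩,
    ⟨e.trans e'⟩⟩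
  obtain ⟨r, hr, b, hb⟩ := hused i
  obtain ⟨y, rfl⟩ := hmap r hr
  exact ⟨y, hr, b, mem_toWord_of_mem_toWord_map hinj hb⟩

/-- The free group is presented by the empty set of relators. -/
theorem nonempty_presentedGroup_empty_mulEquiv (α : Type*) :
    Nonempty (PresentedGroup (∅ : Set (FreeGroup α)) ≃* FreeGroup α) :=
  have h : ∀ r ∈ (∅ : Set (FreeGroup α)), FreeGroup.lift FreeGroup.of r = 1 := fun _ hr => hr.elim
  ⟨MonoidHom.toMulEquiv (PresentedGroup.toGroup h) (PresentedGroup.mk ∅)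
    (PresentedGroup.ext fun i => by rw [MonoidHom.comp_apply, PresentedGroup.toGroup.of]; rfl)
    (FreeGroup.ext_hom _ _ fun i => PresentedGroup.toGroup.of h)⟩

theorem exists_twinPresentations_of_presentedGroups (k : Type u) [Field k] {n : Bool → ℕ}
    (R : ∀ j, Set (FreeGroup (Fin (n j)))) (hR : ∀ j, (R j).Finite) :
    ∃ (O QH QG : FinConnQuiver)
      (L L' : Ideal (PathAlgebra k O.Vert)) (I I' : Ideal (PathAlgebra k QH.Vert))
      (J J' : Ideal (PathAlgebra k QG.Vert))
      (AO : Type u) (_ : Ring AO) (_ : Algebra k AO) (AH : Type u) (_ : Ring AH) (_ : Algebra k AH)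
      (A : Type u) (_ : Ring A) (_ : Algebra k A)
      (ι₁ : O.Vert ⥤q QG.Vert) (ι₂ : QH.Vert ⥤q QG.Vert) (v₁ : O.Vert) (v₂ : QH.Vert),
      IsTwinPresentation k QG J J' A
        (Monoid.Coprod (PresentedGroup (R false)) (PresentedGroup (R true))) ∧
      IsTwinPresentation k O L L' AO (PresentedGroup (R false)) ∧
      IsTwinPresentation k QH I I' AH (PresentedGroup (R true)) ∧
      IsWedge ι₁ ι₂ v₁ v₂ ∧
      J = coproductIdeal ι₁ ι₂ L I ∧ J' = coproductIdeal ι₁ ι₂ L' I' := by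
  -- Indexing the rays by `Bool` yields the free product; the stars indexed by `Unit` below yield
  -- its two factors.
  have hG := isTwinPresentation_presIdeal k hR
    (G := Monoid.Coprod (PresentedGroup (R false)) (PresentedGroup (R true)))
    (fun j => match j with | false => Monoid.Coprod.inl | true => Monoid.Coprod.inr)
    (fun φ => ⟨Monoid.Coprod.lift (φ false) (φ true), by
      rintro (_ | _)
      · exact Monoid.Coprod.lift_comp_inl _ _
      · exact Monoid.Coprod.lift_comp_inr _ _⟩)
    (fun θ hθ => Monoid.Coprod.hom_ext (hθ false) (hθ true))
  have hray : ∀ j, IsTwinPresentation k (presQuiver (fun _ : Unit => R j) fun _ => hR j)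
      (presIdeal (fun _ : Unit => R j) k false) (presIdeal (fun _ : Unit => R j) k true)
      (PathAlgebra k (PresStar fun _ : Unit => R j) ⧸ presIdeal (fun _ : Unit => R j) k false)
      (PresentedGroup (R j)) := fun j =>
    isTwinPresentation_presIdeal k _ (fun _ => MonoidHom.id _) (fun φ => ⟨φ (), fun _ => rfl⟩)
      fun θ hθ => hθ ()
  exact ⟨_, _, _, _, _, _, _, _, _, _, _, _, _, _, _, _, _, _, _, _, _, _, hG, hray false,
    hray true, Star.isWedge_rayMap _ _, Star.labelIdeal_eq_coproductIdeal _,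
    Star.labelIdeal_eq_coproductIdeal _⟩

end BoundQuiver

theorem mainTheorem3 (k : Type u) [Field k] (G : Type v) [Group G]
    [Group.IsFinitelyPresented G] :
    (∃ (m : ℕ) (H : Type) (_ : Group H),
      BoundQuiver.HasPresentationWithoutFreeGenerators H ∧
        Nonempty (G ≃* Monoid.Coprod (FreeGroup (Fin m)) H)) ∧
    ∀ (m : ℕ) (H : Type w) [Group H],
      BoundQuiver.HasPresentationWithoutFreeGenerators H →
      Nonempty (G ≃* Monoid.Coprod (FreeGroup (Fin m)) H) →
      ∃ (O QH QG : BoundQuiver.FinConnQuiver)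
        (L L' : Ideal (BoundQuiver.PathAlgebra k O.Vert))
        (I I' : Ideal (BoundQuiver.PathAlgebra k QH.Vert))
        (J J' : Ideal (BoundQuiver.PathAlgebra k QG.Vert))
        (AO : Type u) (_ : Ring AO) (_ : Algebra k AO)
        (AH : Type u) (_ : Ring AH) (_ : Algebra k AH)
        (A : Type u) (_ : Ring A) (_ : Algebra k A)
        (ι₁ : O.Vert ⥤q QG.Vert) (ι₂ : QH.Vert ⥤q QG.Vert) (v₁ : O.Vert) (v₂ : QH.Vert),
        BoundQuiver.IsTwinPresentation k QG J J' A G ∧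
        BoundQuiver.IsTwinPresentation k O L L' AO (FreeGroup (Fin m)) ∧
        BoundQuiver.IsTwinPresentation k QH I I' AH H ∧
        BoundQuiver.IsWedge ι₁ ι₂ v₁ v₂ ∧
        J = BoundQuiver.coproductIdeal ι₁ ι₂ L I ∧
        J' = BoundQuiver.coproductIdeal ι₁ ι₂ L' I' := by
  refine ⟨BoundQuiver.exists_coprod_presentationWithoutFreeGenerators G, ?_⟩
  rintro m H _ ⟨n, R, hR, -, ⟨eH⟩⟩ ⟨eG⟩
  -- Presented without relators, the free factor is covered by the same construction as `H`.
  obtain ⟨eO⟩ := BoundQuiver.nonempty_presentedGroup_empty_mulEquiv (Fin m)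
  obtain ⟨O, QH, QG, L, L', I, I', J, J', AO, _, _, AH, _, _, A, _, _, ι₁, ι₂, v₁, v₂, hG, hO, hH,
    hW, hJ, hJ'⟩ := BoundQuiver.exists_twinPresentations_of_presentedGroups k
      (n := fun j => match j with | false => m | true => n)
      (fun j => match j with | false => ∅ | true => R)
      (fun j => match j with | false => Set.finite_empty | true => hR)
  exact ⟨O, QH, QG, L, L', I, I', J, J', AO, _, _, AH, _, _, A, _, _, ι₁, ι₂, v₁, v₂,
    hG.congr ((MulEquiv.coprodCongr eO eH).trans eG.symm), hO.congr eO, hH.congr eH, hW, hJ, hJ'⟩
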